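/- Let $U,V,H$ be real separable Hilbert spaces with $V\subset H$ densely and compactly embedded, let $T>0$, and let $W(0,T)=H^1(0,T;V')\cap L^2(0,T;V)$. Let $A\in L^\infty(0,T;\mathcal L(V,V'))$ be uniformly coercive, i.e. there is $\eta_V>0$ with $\langle A(t)v,v\rangle_{V',V}\ge\eta_V|v|_V^2$ for almost all $t\in(0,T)$ and all $v\in V$, and let $C\in L^\infty(0,T;\mathcal L(H,H))$, $B\in\mathcal L(U,V')$, $\beta>0$, $y_d\in L^2(0,T;H)$ and $y_0\in H$. Consider the optimal control problem of minimizing $$J(y,u)=\int_0^T \tfrac12|C(t)y(t)-y_d(t)|_H^2+\tfrac\beta2|u(t)|_U^2\,dt$$ over all $(y,u)\in W(0,T)\times L^2(0,T;U)$ satisfying $$\partial_t y(t)+A(t)y(t)=Bu(t)\ \text{ in } V' \text{ for almost all } t\in(0,T),\qquad y(0)=y_0\ \text{ in } H. \tag{1}$$ For every $u\in L^2(0,T;U)$, (1) has exactly one solution $y(u)\in W(0,T)$; for the initial value $0$ in place of $y_0$ the unique solution is $\mathcal S u$ with a bounded linear operator $\mathcal S\in\mathcal L(L^2(0,T;U),W(0,T))$;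 the optimal control problem has exactly one optimal control $\bar u\in L^2(0,T;U)$; and the reduced cost $\hat J(u)=J(y(u),u)$ is differentiable on $L^2(0,T;U)$. Moreover, for every $\tilde u\in L^2(0,T;U)$, $$\frac{1}{\beta+\|C\mathcal S\|^2}\,\bigl|\nabla\hat J(\tilde u)\bigr|_{L^2(0,T;U)}\ \le\ |\bar u-\tilde u|_{L^2(0,T;U)}\ \le\ \frac1\beta\,\bigl|\nabla\hat J(\tilde u)\bigr|_{L^2(0,T;U)},$$ where $\nabla\hat J(\tilde u)$ is the gradient of $\hat J$ at $\tilde u$ in $L^2(0,T;U)$ and $\|C\mathcal S\|$ is the operator norm of $C\mathcal S: L^2(0,T;U)\to L^2(0,T;H)$, $u\mapsto \bigl(t\mapsto C(t)(\mathcal S u)(t)\bigr)$. -/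

import Mathlib

open MeasureTheory Set
open scoped ENNReal ContDiff RealInnerProductSpace

noncomputable section

/-- Lebesgue measure on the open time interval `(0,T)`. -/
abbrev timeMeasure (T : ℝ) : Measure ℝ := volume.restrict (Ioo 0 T)

/-- The Bochner space `L²(0,T;X)`. -/
abbrev L2Time (T : ℝ) (X : Type*) [NormedAddCommGroup X] : Type _ := Lp X 2 (timeMeasure T)

/-- The Bochner space `L^∞(0,T;X)`. -/
abbrev LInfTime (T : ℝ) (X : Type*) [NormedAddCommGroup X] : Type _ := Lp X ∞ (timeMeasure T)

/-- `φ ∈ C_c^∞((0,T))`. -/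
def IsTestFunction (T : ℝ) (φ : ℝ → ℝ) : Prop :=
  ContDiff ℝ ∞ φ ∧ HasCompactSupport φ ∧ tsupport φ ⊆ Ioo 0 T

/-- `g` is the weak (distributional) time derivative of `f` on `(0,T)`, both being in
`L²(0,T;X)`: `∫ φ' f = - ∫ φ g` in `X` for every test function `φ`. -/
def IsWeakTimeDeriv {X : Type*} [NormedAddCommGroup X] [NormedSpace ℝ X] (T : ℝ)
    (f g : L2Time T X) : Prop :=
  ∀ φ : ℝ → ℝ, IsTestFunction T φ →
    ∫ t, deriv φ t • f t ∂(timeMeasure T) = -∫ t, φ t • g t ∂(timeMeasure T)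

section Integrability

variable {X : Type*} [NormedAddCommGroup X] [NormedSpace ℝ X] {T : ℝ}

theorem integrable_bounded_smul {ψ : ℝ → ℝ} (hc : Continuous ψ) (hs : HasCompactSupport ψ)
    (f : L2Time T X) : Integrable (fun t => ψ t • f t) (timeMeasure T) := by
  have hf : Integrable (fun t => f t) (timeMeasure T) :=
    (Lp.memLp f).integrable (by norm_num)
  obtain ⟨M, hM⟩ := hs.exists_bound_of_continuous hc
  exact hf.bdd_smul M hc.aestronglyMeasurable (Filter.Eventually.of_forall hM)

theorem IsTestFunction.integrable_smul {φ : ℝ → ℝ} (h : IsTestFunction T φ) (f : L2Time T X) :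
    Integrable (fun t => φ t • f t) (timeMeasure T) :=
  integrable_bounded_smul h.1.continuous h.2.1 f

theorem IsTestFunction.integrable_deriv_smul {φ : ℝ → ℝ} (h : IsTestFunction T φ)
    (f : L2Time T X) : Integrable (fun t => deriv φ t • f t) (timeMeasure T) :=
  integrable_bounded_smul (h.1.continuous_deriv (by simp)) h.2.1.deriv f

theorem IsWeakTimeDeriv.zero : IsWeakTimeDeriv T (0 : L2Time T X) 0 := by
  intro φ _
  have h0 : ((0 : L2Time T X) : ℝ → X) =ᵐ[timeMeasure T] 0 := Lp.coeFn_zero _ _ _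
  rw [integral_eq_zero_of_ae, integral_eq_zero_of_ae, neg_zero]
  · filter_upwards [h0] with t ht
    rw [ht, Pi.zero_apply, smul_zero]
  · filter_upwards [h0] with t ht
    rw [ht, Pi.zero_apply, smul_zero]

theorem IsWeakTimeDeriv.add {f₁ g₁ f₂ g₂ : L2Time T X} (h₁ : IsWeakTimeDeriv T f₁ g₁)
    (h₂ : IsWeakTimeDeriv T f₂ g₂) : IsWeakTimeDeriv T (f₁ + f₂) (g₁ + g₂) := by
  intro φ hφ
  have e₁ : ∫ t, deriv φ t • (f₁ + f₂ : L2Time T X) t ∂(timeMeasure T)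
      = ∫ t, (deriv φ t • f₁ t + deriv φ t • f₂ t) ∂(timeMeasure T) := by
    refine integral_congr_ae ?_
    filter_upwards [Lp.coeFn_add f₁ f₂] with t ht
    rw [ht, Pi.add_apply, smul_add]
  have e₂ : ∫ t, φ t • (g₁ + g₂ : L2Time T X) t ∂(timeMeasure T)
      = ∫ t, (φ t • g₁ t + φ t • g₂ t) ∂(timeMeasure T) := by
    refine integral_congr_ae ?_
    filter_upwards [Lp.coeFn_add g₁ g₂] with t ht
    rw [ht, Pi.add_apply, smul_add]
  rw [e₁, e₂, integral_add (hφ.integrable_deriv_smul f₁) (hφ.integrable_deriv_smul f₂),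
    integral_add (hφ.integrable_smul g₁) (hφ.integrable_smul g₂), h₁ φ hφ, h₂ φ hφ, neg_add]

theorem IsWeakTimeDeriv.smul (c : ℝ) {f g : L2Time T X} (h : IsWeakTimeDeriv T f g) :
    IsWeakTimeDeriv T (c • f) (c • g) := by
  intro φ hφ
  have e₁ : ∫ t, deriv φ t • (c • f : L2Time T X) t ∂(timeMeasure T)
      = ∫ t, c • (deriv φ t • f t) ∂(timeMeasure T) := by
    refine integral_congr_ae ?_
    filter_upwards [Lp.coeFn_smul c f] with t ht
    rw [ht, Pi.smul_apply, smul_comm]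
  have e₂ : ∫ t, φ t • (c • g : L2Time T X) t ∂(timeMeasure T)
      = ∫ t, c • (φ t • g t) ∂(timeMeasure T) := by
    refine integral_congr_ae ?_
    filter_upwards [Lp.coeFn_smul c g] with t ht
    rw [ht, Pi.smul_apply, smul_comm]
  rw [e₁, e₂, integral_smul, integral_smul, h φ hφ, smul_neg]

end Integrability

section GelfandTriple

variable {V H : Type*} [NormedAddCommGroup V] [InnerProductSpace ℝ V]
  [NormedAddCommGroup H] [InnerProductSpace ℝ H]

/-- The embedding `V ⊂ H ≅ H' ⊂ V'` of the Gelfand triple with `ι : V → H`: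
it sends `v` to the functional `w ↦ ⟪ι v, ι w⟫`. -/
def toDualV (ι : V →L[ℝ] H) : V →L[ℝ] StrongDual ℝ V :=
  ContinuousLinearMap.bilinearComp
    (isBoundedBilinearMap_inner (𝕜 := ℝ) (E := H)).toContinuousLinearMap ι ι

@[simp] theorem toDualV_apply (ι : V →L[ℝ] H) (v w : V) : toDualV ι v w = ⟪ι v, ι w⟫ := rfl

/-- The state space `W(0,T) = H¹(0,T;V') ∩ L²(0,T;V)`, realised as the subspace of
`L²(0,T;V) × L²(0,T;V')` of all pairs `(y, y')` such that `y'` is the weak derivative of `y`,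
with the norm `(|y|² + |y'|²)^{1/2}`. -/
def StateSpace (T : ℝ) (ι : V →L[ℝ] H) :
    Submodule ℝ (WithLp 2 (L2Time T V × L2Time T (StrongDual ℝ V))) where
  carrier := {p | IsWeakTimeDeriv T ((toDualV ι).compLpL 2 (timeMeasure T) p.fst) p.snd}
  zero_mem' := by
    simpa using IsWeakTimeDeriv.zero (X := StrongDual ℝ V) (T := T)
  add_mem' := by
    intro p q hp hq
    simpa using IsWeakTimeDeriv.add hp hq
  smul_mem' := by
    intro c p hp
    simpa using IsWeakTimeDeriv.smul c hp

/-- The embedding `W(0,T) → L²(0,T;V)`. -/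
def StateSpace.toL2 (T : ℝ) (ι : V →L[ℝ] H) : StateSpace T ι →L[ℝ] L2Time T V :=
  (WithLp.fstL 2 ℝ (L2Time T V) (L2Time T (StrongDual ℝ V))).comp (StateSpace T ι).subtypeL

/-- The weak time derivative `W(0,T) → L²(0,T;V')`. -/
def StateSpace.timeDeriv (T : ℝ) (ι : V →L[ℝ] H) :
    StateSpace T ι →L[ℝ] L2Time T (StrongDual ℝ V) :=
  (WithLp.sndL 2 ℝ (L2Time T V) (L2Time T (StrongDual ℝ V))).comp (StateSpace T ι).subtypeL

/-- `y(0) = y₀` in `H`, where `y ∈ W(0,T)` is identified with its representative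
in `C([0,T];H)`. -/
def HasInitialValue {T : ℝ} {ι : V →L[ℝ] H} (y : StateSpace T ι) (y₀ : H) : Prop :=
  ∃ z : ℝ → H, ContinuousOn z (Icc 0 T) ∧
    (∀ᵐ t ∂(timeMeasure T), z t = ι (StateSpace.toL2 T ι y t)) ∧ z 0 = y₀

end GelfandTriple

/-- The data of the linear-quadratic optimal control problem
`min ∫₀ᵀ ½|C(t) y(t) - y_d(t)|²_H + (β/2)|u(t)|²_U dt` subject to
`∂ₜ y + A(t) y = B u` in `V'`, `y(0) = y₀` in `H`, for a dense and compact embedding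
`ι : V → H`. -/
structure ControlProblem (U V H : Type*)
    [NormedAddCommGroup U] [InnerProductSpace ℝ U]
    [NormedAddCommGroup V] [InnerProductSpace ℝ V]
    [NormedAddCommGroup H] [InnerProductSpace ℝ H] where
  /-- the final time -/
  T : ℝ
  T_pos : 0 < T
  /-- the embedding of `V` into `H` -/
  ι : V →L[ℝ] H
  ι_injective : Function.Injective ι
  ι_denseRange : DenseRange ι
  ι_compact : IsCompactOperator ι
  /-- the operator `A ∈ L^∞(0,T;𝓛(V,V'))` of the state equation -/
  A : LInfTime T (V →L[ℝ] StrongDual ℝ V)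
  A_coercive : ∃ η : ℝ, 0 < η ∧ ∀ᵐ t ∂(timeMeasure T), ∀ v : V, η * ‖v‖ ^ 2 ≤ A t v v
  /-- the observation operator `C ∈ L^∞(0,T;𝓛(H,H))` -/
  C : LInfTime T (H →L[ℝ] H)
  /-- the control operator `B ∈ 𝓛(U,V')` -/
  B : U →L[ℝ] StrongDual ℝ V
  /-- the regularisation parameter -/
  β : ℝ
  β_pos : 0 < β
  /-- the desired state -/
  yd : L2Time T H
  /-- the initial value -/
  y₀ : H

namespace ControlProblem

variable {U V H : Type*}
  [NormedAddCommGroup U] [InnerProductSpace ℝ U]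
  [NormedAddCommGroup V] [InnerProductSpace ℝ V]
  [NormedAddCommGroup H] [InnerProductSpace ℝ H]

/-- The state space `W(0,T)` of the problem. -/
abbrev W (P : ControlProblem U V H) : Submodule ℝ
    (WithLp 2 (L2Time P.T V × L2Time P.T (StrongDual ℝ V))) := StateSpace P.T P.ι

/-- `y ∈ W(0,T)` solves `∂ₜ y(t) + A(t) y(t) = B u(t)` in `V'` for almost all `t ∈ (0,T)`, and
`y(0) = a` in `H`. -/
def SolvesState (P : ControlProblem U V H) (a : H) (u : L2Time P.T U) (y : P.W) : Prop :=
  (∀ᵐ t ∂(timeMeasure P.T),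
    StateSpace.timeDeriv P.T P.ι y t + P.A t (StateSpace.toL2 P.T P.ι y t) = P.B (u t)) ∧
  HasInitialValue y a

/-- The cost functional `J(y,u)`. -/
def cost (P : ControlProblem U V H) (y : P.W) (u : L2Time P.T U) : ℝ :=
  ∫ t, ((1 / 2) * ‖P.C t (P.ι (StateSpace.toL2 P.T P.ι y t)) - P.yd t‖ ^ 2
    + (P.β / 2) * ‖u t‖ ^ 2) ∂(timeMeasure P.T)

/-- `ū` is a solution of the optimal control problem: together with an associated state it
minimises `J(y,u)` over all pairs `(y,u) ∈ W(0,T) × L²(0,T;U)` that solve the state equation. -/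
def IsOptimalControl (P : ControlProblem U V H) (ubar : L2Time P.T U) : Prop :=
  ∃ ybar : P.W, P.SolvesState P.y₀ ubar ybar ∧
    ∀ (y : P.W) (u : L2Time P.T U), P.SolvesState P.y₀ u y → P.cost ybar ubar ≤ P.cost y u

/-- The control-to-state map `u ↦ y(u)`. -/
def state (P : ControlProblem U V H) (u : L2Time P.T U) : P.W :=
  Classical.epsilon fun y => P.SolvesState P.y₀ u y

/-- The reduced cost function `Ĵ(u) = J(y(u),u)`. -/
def reducedCost (P : ControlProblem U V H) (u : L2Time P.T U) : ℝ := P.cost (P.state u) u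

/-- The bounded linear solution operator `𝓢 : L²(0,T;U) → W(0,T)` of the state equation with
initial value `0`. -/
def solutionOperator (P : ControlProblem U V H) : L2Time P.T U →L[ℝ] P.W :=
  Classical.epsilon fun S : L2Time P.T U →L[ℝ] P.W => ∀ u, P.SolvesState 0 u (S u)

/-- The observation `L²(0,T;H) → L²(0,T;H)`, `y ↦ (t ↦ C(t) y(t))`. -/
def observation (P : ControlProblem U V H) : L2Time P.T H →L[ℝ] L2Time P.T H :=
  (ContinuousLinearMap.id ℝ (H →L[ℝ] H)).holderL (timeMeasure P.T) ∞ 2 2 P.C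

/-- The operator `C𝓢 : L²(0,T;U) → L²(0,T;H)`, `u ↦ (t ↦ C(t) (𝓢u)(t))`. -/
def observedSolutionOperator (P : ControlProblem U V H) : L2Time P.T U →L[ℝ] L2Time P.T H :=
  P.observation ∘L P.ι.compLpL 2 (timeMeasure P.T) ∘L StateSpace.toL2 P.T P.ι ∘L
    P.solutionOperator

end ControlProblem

end

noncomputable section

/-! ### Continuous functions as elements of `L²(0,T;X)` -/

section ContinuousRepresentatives

variable {X : Type*} [NormedAddCommGroup X] {T : ℝ}

/-! The heart of the matter is that the parabolic operator `y ↦ (∂ₜy + Ay, y(0))` is an isomorphism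
of `W(0,T)` onto `L²(0,T;V') × H`. The state is then affine in the control, `y(u) = 𝓢u + ŷ`, and
with `F = C𝓢` and `d = Cŷ - y_d` the reduced cost is `½|Fu + d|² + (β/2)|u|²`. Its gradient `F*(Fu +
d) + βu` has a zero `ū` by Lax–Milgram, and the exact second-order expansion makes `ū` the only
minimiser. Hence `∇Ĵ(ũ) = (F*F + β)(ũ - ū)`: the operator norm of `F*F + β` gives the lower bound
for `|ū - ũ|`, and pairing with `ũ - ū` gives the upper one.

For the isomorphism, the energy estimate (`exists_norm_le_parabolicOperator`) yields injectivity and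
closed range. A pair `(p,h)` orthogonal to the range is a weak solution of the backward equation
`∂ₜp = A'p` with `p(T) = 0` and `p(0) = h`, and coercivity forces it to vanish
(`eq_zero_of_annihilates`).

Both arguments need traces in `H` and integration by parts in `W(0,T)`. These are checked on `C¹`
functions with values in `V` and extended by density (`denseRange_ofSmooth`). Density uses
regularisation in space: with `G` the embedding `V → V'` followed by Riesz, the resolvent `(G +
ε)⁻¹` moves the derivative from `V'` into `V`. There the problem is that of `H¹(0,T;V)`, settled by
primitives and the lemma of du Bois-Reymond. -/

theorem L2Time.integrable (f : L2Time T X) : Integrable f (timeMeasure T) :=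
  (Lp.memLp f).integrable (by norm_num)

theorem Continuous.memLp_timeMeasure {w : ℝ → X} (hw : Continuous w) (T : ℝ) (p : ℝ≥0∞) :
    MemLp w p (timeMeasure T) := by
  obtain ⟨C, hC⟩ := (isCompact_Icc (a := (0 : ℝ)) (b := T)).exists_bound_of_continuousOn
    hw.continuousOn
  refine MemLp.of_bound hw.aestronglyMeasurable C ?_
  filter_upwards [ae_restrict_mem measurableSet_Ioo] with t ht
  exact hC t (Ioo_subset_Icc_self ht)

/-- The class in `L²(0,T;X)` of a continuous function. -/
def continuousToL2 (T : ℝ) (w : ℝ → X) (hw : Continuous w) : L2Time T X :=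
  (hw.memLp_timeMeasure T 2).toLp w

theorem coeFn_continuousToL2 (T : ℝ) {w : ℝ → X} (hw : Continuous w) :
    continuousToL2 T w hw =ᵐ[timeMeasure T] w :=
  MemLp.coeFn_toLp _

end ContinuousRepresentatives

/-! ### Weak time derivatives, primitives and density of `C¹` in `H¹(0,T;X)` -/

section WeakTimeDerivative

variable {X Y : Type*} [NormedAddCommGroup X] [NormedSpace ℝ X]
  [NormedAddCommGroup Y] [NormedSpace ℝ Y] {T : ℝ}

/-- The functional `f ↦ ∫ ψ f` on `L²(0,T;X)` for continuous `ψ`. -/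
def weightedIntegral [CompleteSpace X] (T : ℝ) (ψ : ℝ → ℝ) (hψ : Continuous ψ) :
    L2Time T X →L[ℝ] X :=
  (ContinuousLinearMap.lsmul ℝ ℝ).lpPairing (timeMeasure T) 2 2 (continuousToL2 T ψ hψ)

theorem weightedIntegral_apply [CompleteSpace X] {ψ : ℝ → ℝ} (hψ : Continuous ψ)
    (f : L2Time T X) : weightedIntegral T ψ hψ f = ∫ t, ψ t • f t ∂(timeMeasure T) := by
  rw [weightedIntegral, ContinuousLinearMap.lpPairing_eq_integral]
  refine integral_congr_ae ?_
  filter_upwards [coeFn_continuousToL2 T hψ] with t ht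
  simp [ht]

theorem IsTestFunction.continuous_deriv {φ : ℝ → ℝ} (h : IsTestFunction T φ) :
    Continuous (deriv φ) :=
  h.1.continuous_deriv (by simp)

theorem isWeakTimeDeriv_iff [CompleteSpace X] {f g : L2Time T X} :
    IsWeakTimeDeriv T f g ↔ ∀ (φ : ℝ → ℝ) (hφ : IsTestFunction T φ),
      weightedIntegral T (deriv φ) hφ.continuous_deriv f
        = -weightedIntegral T φ hφ.1.continuous g := by
  simp only [weightedIntegral_apply]
  rfl

/-- For each fixed test function both sides are bounded operators on `L²`. This closedness gives
completeness of `W(0,T)` and allows density arguments. -/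
theorem isClosed_setOf_isWeakTimeDeriv [CompleteSpace X] {Z : Type*} [TopologicalSpace Z]
    {F G : Z → L2Time T X} (hF : Continuous F) (hG : Continuous G) :
    IsClosed {z | IsWeakTimeDeriv T (F z) (G z)} := by
  simp only [isWeakTimeDeriv_iff, ofPred_forall]
  exact isClosed_iInter fun φ => isClosed_iInter fun hφ =>
    isClosed_eq ((ContinuousLinearMap.continuous _).comp hF)
      ((ContinuousLinearMap.continuous _).comp hG).neg

theorem IsWeakTimeDeriv.map [CompleteSpace X] [CompleteSpace Y] (L : X →L[ℝ] Y)
    {f g : L2Time T X} (h : IsWeakTimeDeriv T f g) :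
    IsWeakTimeDeriv T (L.compLpL 2 (timeMeasure T) f) (L.compLpL 2 (timeMeasure T) g) := by
  have key : ∀ (ψ : ℝ → ℝ) (k : L2Time T X), Integrable (fun t => ψ t • k t) (timeMeasure T) →
      ∫ t, ψ t • (L.compLpL 2 (timeMeasure T) k) t ∂(timeMeasure T)
        = L (∫ t, ψ t • k t ∂(timeMeasure T)) := by
    intro ψ k hk
    rw [← L.integral_comp_comm hk]
    refine integral_congr_ae ?_
    filter_upwards [L.coeFn_compLpL k] with t ht
    rw [ht, map_smul]
  intro φ hφ
  rw [key _ _ (hφ.integrable_deriv_smul f), key _ _ (hφ.integrable_smul g), h φ hφ, map_neg]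

theorem IsTestFunction.eq_zero {φ : ℝ → ℝ} (h : IsTestFunction T φ) {t : ℝ}
    (ht : t ∉ Ioo 0 T) : φ t = 0 :=
  image_eq_zero_of_notMem_tsupport fun h' => ht (h.2.2 h')

/-- The fundamental theorem of calculus for `φ w`; the boundary terms vanish because `φ` is zero
outside the open interval. -/
theorem isWeakTimeDeriv_continuousToL2 [CompleteSpace X] (hT : 0 ≤ T) {w w' : ℝ → X}
    (hw : ∀ t, HasDerivAt w (w' t) t) (hw' : Continuous w') (hwc : Continuous w) :
    IsWeakTimeDeriv T (continuousToL2 T w hwc) (continuousToL2 T w' hw') := by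
  intro φ hφ
  have e₁ : ∫ t, deriv φ t • continuousToL2 T w hwc t ∂(timeMeasure T)
      = ∫ t, deriv φ t • w t ∂(timeMeasure T) :=
    integral_congr_ae (by filter_upwards [coeFn_continuousToL2 T hwc] with t ht; rw [ht])
  have e₂ : ∫ t, φ t • continuousToL2 T w' hw' t ∂(timeMeasure T)
      = ∫ t, φ t • w' t ∂(timeMeasure T) :=
    integral_congr_ae (by filter_upwards [coeFn_continuousToL2 T hw'] with t ht; rw [ht])
  have hc₁ : Continuous fun t => deriv φ t • w t := hφ.continuous_deriv.smul hwc
  have hc₂ : Continuous fun t => φ t • w' t := hφ.1.continuous.smul hw'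
  have hd : ∀ t ∈ uIcc 0 T, HasDerivAt (fun t => φ t • w t) (φ t • w' t + deriv φ t • w t) t :=
    fun t _ => ((hφ.1.differentiable (by simp)) t).hasDerivAt.smul (hw t)
  have h := intervalIntegral.integral_eq_sub_of_hasDerivAt hd
    ((hc₂.add hc₁).intervalIntegrable _ _)
  rw [hφ.eq_zero (t := 0) (by simp), hφ.eq_zero (t := T) (by simp), zero_smul, zero_smul,
    sub_zero, intervalIntegral.integral_of_le hT, integral_Ioc_eq_integral_Ioo,
    integral_add (memLp_one_iff_integrable.1 (hc₂.memLp_timeMeasure T 1))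
      (memLp_one_iff_integrable.1 (hc₁.memLp_timeMeasure T 1))] at h
  rw [e₁, e₂, eq_neg_iff_add_eq_zero, add_comm, h]

theorem L2Time.integral_norm_le (T : ℝ) (X : Type*) [NormedAddCommGroup X] :
    ∃ C : ℝ, 0 ≤ C ∧ ∀ f : L2Time T X, ∫ t, ‖f t‖ ∂(timeMeasure T) ≤ C * ‖f‖ := by
  refine ⟨((timeMeasure T univ) ^ (1 / (1 : ℝ≥0∞).toReal - 1 / (2 : ℝ≥0∞).toReal)).toReal,
    ENNReal.toReal_nonneg, fun f => ?_⟩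
  have h := eLpNorm_le_eLpNorm_mul_rpow_measure_univ (p := 1) (q := 2) (by norm_num)
    (Lp.aestronglyMeasurable f)
  rw [integral_norm_eq_lintegral_enorm (Lp.aestronglyMeasurable f),
    ← eLpNorm_one_eq_lintegral_enorm, Lp.norm_def, mul_comm, ← ENNReal.toReal_mul]
  refine ENNReal.toReal_mono (ENNReal.mul_ne_top (Lp.eLpNorm_ne_top f) ?_) h
  exact ENNReal.rpow_ne_top_of_nonneg (by norm_num) (measure_ne_top _ _)

theorem L2Time.continuous_primitive (f : L2Time T X) :
    Continuous fun t => ∫ s in (0 : ℝ)..t, f s ∂(timeMeasure T) :=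
  intervalIntegral.continuous_primitive (fun _ _ => f.integrable.intervalIntegrable) 0

theorem L2Time.norm_primitive_le (f : L2Time T X) (t : ℝ) :
    ‖∫ s in (0 : ℝ)..t, f s ∂(timeMeasure T)‖ ≤ ∫ s, ‖f s‖ ∂(timeMeasure T) :=
  intervalIntegral.norm_integral_le_integral_norm_uIoc.trans
    (setIntegral_le_integral f.integrable.norm (Filter.Eventually.of_forall fun _ => norm_nonneg _))

/-- The primitive `t ↦ ∫₀ᵗ f` as a bounded linear operator on `L²(0,T;X)`. -/
def L2Time.primitive (T : ℝ) (X : Type*) [NormedAddCommGroup X] [NormedSpace ℝ X] :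
    L2Time T X →L[ℝ] L2Time T X :=
  LinearMap.mkContinuousOfExistsBound
    { toFun := fun f => continuousToL2 T _ f.continuous_primitive
      map_add' := by
        intro f g
        refine Lp.ext ?_
        filter_upwards [coeFn_continuousToL2 T (f + g).continuous_primitive,
          coeFn_continuousToL2 T f.continuous_primitive,
          coeFn_continuousToL2 T g.continuous_primitive, Lp.coeFn_add
            (continuousToL2 T _ f.continuous_primitive)
            (continuousToL2 T _ g.continuous_primitive)] with t h₁ h₂ h₃ h₄
        rw [h₁, h₄, Pi.add_apply, h₂, h₃, ← intervalIntegral.integral_add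
          f.integrable.intervalIntegrable g.integrable.intervalIntegrable]
        refine intervalIntegral.integral_congr_ae ?_
        filter_upwards [Lp.coeFn_add f g] with s hs _
        rw [hs, Pi.add_apply]
      map_smul' := by
        intro c f
        refine Lp.ext ?_
        filter_upwards [coeFn_continuousToL2 T (c • f).continuous_primitive,
          coeFn_continuousToL2 T f.continuous_primitive, Lp.coeFn_smul c
            (continuousToL2 T _ f.continuous_primitive)] with t h₁ h₂ h₄
        rw [h₁, RingHom.id_apply, h₄, Pi.smul_apply, h₂, ← intervalIntegral.integral_smul]
        refine intervalIntegral.integral_congr_ae ?_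
        filter_upwards [Lp.coeFn_smul c f] with s hs _
        rw [hs, Pi.smul_apply] }
    (by
      obtain ⟨C, hC, h⟩ := L2Time.integral_norm_le T X
      refine ⟨measureUnivNNReal (timeMeasure T) ^ (2 : ℝ≥0∞).toReal⁻¹ * C, fun f => ?_⟩
      rw [mul_assoc]
      refine Lp.norm_le_of_ae_bound (by positivity) ?_
      filter_upwards [coeFn_continuousToL2 T f.continuous_primitive] with t ht
      exact (congrArg norm ht).trans_le ((f.norm_primitive_le t).trans (h f)))

theorem L2Time.coeFn_primitive (f : L2Time T X) :
    L2Time.primitive T X f =ᵐ[timeMeasure T] fun t => ∫ s in (0 : ℝ)..t, f s ∂(timeMeasure T) :=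
  coeFn_continuousToL2 T f.continuous_primitive

theorem hasDerivAt_primitive [CompleteSpace X] {k : ℝ → X} (hk : Continuous k) (t : ℝ) :
    HasDerivAt (fun t => ∫ s in (0 : ℝ)..t, k s) (k t) t :=
  hk.integral_hasStrictDerivAt 0 t |>.hasDerivAt

theorem continuous_integral_primitive [CompleteSpace X] {k : ℝ → X} (hk : Continuous k) :
    Continuous (fun t => ∫ s in (0 : ℝ)..t, k s) :=
  continuous_iff_continuousAt.2 fun t => (hasDerivAt_primitive hk t).continuousAt

theorem L2Time.primitive_continuousToL2 [CompleteSpace X] {k : ℝ → X} (hk : Continuous k) :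
    L2Time.primitive T X (continuousToL2 T k hk)
      = continuousToL2 T _ (continuous_integral_primitive hk) := by
  refine Lp.ext ?_
  filter_upwards [L2Time.coeFn_primitive (continuousToL2 T k hk),
    coeFn_continuousToL2 T (continuous_integral_primitive hk),
    ae_restrict_mem measurableSet_Ioo] with t h₁ h₂ ht
  rw [h₁, h₂, intervalIntegral.integral_congr_ae (g := k)
    (by filter_upwards [coeFn_continuousToL2 T hk] with s hs _ using hs),
    intervalIntegral.integral_of_le ht.1.le, intervalIntegral.integral_of_le ht.1.le,
    Measure.restrict_restrict measurableSet_Ioc]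
  -- The primitive integrates against the restricted measure, which agrees with Lebesgue measure on
  -- `(0,t]` because `t < T`.
  congr 2
  ext s
  simp only [mem_inter_iff, mem_Ioc, mem_Ioo]
  exact ⟨fun h => h.1, fun h => ⟨h, h.1, h.2.trans_lt ht.2⟩⟩

theorem continuousToL2_approx (T : ℝ) (f : L2Time T X) {ε : ℝ} (hε : 0 < ε) :
    ∃ (k : ℝ → X) (hk : Continuous k), ‖continuousToL2 T k hk - f‖ < ε := by
  obtain ⟨k, hk⟩ := (BoundedContinuousFunction.toLp_denseRange (p := 2) X (timeMeasure T) ℝ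
    (by norm_num)).exists_dist_lt f hε
  refine ⟨k, k.continuous, ?_⟩
  rw [dist_comm, dist_eq_norm] at hk
  exact hk

theorem denseRange_continuousToL2 (T : ℝ) (X : Type*) [NormedAddCommGroup X] [NormedSpace ℝ X] :
    DenseRange fun k : {k : ℝ → X // Continuous k} => continuousToL2 T k.1 k.2 := by
  refine Metric.denseRange_iff.2 fun f ε hε => ?_
  obtain ⟨k, hk, h⟩ := continuousToL2_approx T f hε
  exact ⟨⟨k, hk⟩, by rwa [dist_comm, dist_eq_norm]⟩

theorem L2Time.isWeakTimeDeriv_primitive [CompleteSpace X] (hT : 0 ≤ T) (f : L2Time T X) :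
    IsWeakTimeDeriv T (L2Time.primitive T X f) f := by
  refine (denseRange_continuousToL2 T X).induction_on
    (p := fun f => IsWeakTimeDeriv T (L2Time.primitive T X f) f) f
    (isClosed_setOf_isWeakTimeDeriv (ContinuousLinearMap.continuous _) continuous_id) ?_
  rintro ⟨k, hk⟩
  rw [L2Time.primitive_continuousToL2]
  exact isWeakTimeDeriv_continuousToL2 hT (hasDerivAt_primitive hk) hk _

/-- The primitive from `0` vanishes to the left of the support of `φ`, and to its right because the
total integral is zero; it therefore keeps compact support in `(0,T)`. -/
theorem IsTestFunction.exists_primitive {φ : ℝ → ℝ} (h : IsTestFunction T φ) (hT : 0 < T)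
    (h0 : ∫ t, φ t ∂(timeMeasure T) = 0) : ∃ χ, IsTestFunction T χ ∧ deriv χ = φ := by
  obtain ⟨a, b, ha, hb, hab⟩ : ∃ a b, 0 < a ∧ b < T ∧ tsupport φ ⊆ Icc a b := by
    rcases (tsupport φ).eq_empty_or_nonempty with he | hne
    -- For empty support the reversed endpoints make `Icc a b` empty while keeping `0 < a` and `b <
    -- T`.
    · exact ⟨T, 0, hT, hT, by simp [he]⟩
    · have hK : IsCompact (tsupport φ) := h.2.1
      exact ⟨sInf (tsupport φ), sSup (tsupport φ), (h.2.2 (hK.sInf_mem hne)).1,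
        (h.2.2 (hK.sSup_mem hne)).2, fun x hx => ⟨csInf_le hK.bddBelow hx, le_csSup hK.bddAbove hx⟩⟩
  have hout : ∀ t, t ∉ Icc a b → φ t = 0 := fun t ht =>
    image_eq_zero_of_notMem_tsupport fun h' => ht (hab h')
  have hd : ∀ t, HasDerivAt (fun t => ∫ s in (0 : ℝ)..t, φ s) (φ t) t :=
    hasDerivAt_primitive h.1.continuous
  have hderiv : deriv (fun t => ∫ s in (0 : ℝ)..t, φ s) = φ := funext fun t => (hd t).deriv
  have hT0 : ∫ s in (0 : ℝ)..T, φ s = 0 := by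
    rw [intervalIntegral.integral_of_le hT.le, integral_Ioc_eq_integral_Ioo, h0]
  have hsupp : ∀ t, t ∉ Icc a b → ∫ s in (0 : ℝ)..t, φ s = 0 := by
    intro t ht
    rw [mem_Icc, not_and_or, not_le, not_le] at ht
    rcases ht with ht | ht
    · refine (intervalIntegral.integral_congr (g := fun _ => 0) fun s hs =>
        hout s fun hs' => ?_).trans (by simp)
      rcases le_max_iff.1 hs.2 with h3 | h3
      · linarith [hs'.1]
      · linarith [hs'.1]
    · rw [← intervalIntegral.integral_add_adjacent_intervals (b := T)
        (h.1.continuous.intervalIntegrable _ _) (h.1.continuous.intervalIntegrable _ _), hT0,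
        zero_add]
      refine (intervalIntegral.integral_congr (g := fun _ => 0) fun s hs =>
        hout s fun hs' => ?_).trans (by simp)
      rcases min_le_iff.1 hs.1 with h3 | h3
      · linarith [hs'.2]
      · linarith [hs'.2]
  refine ⟨fun t => ∫ s in (0 : ℝ)..t, φ s, ⟨?_, ?_, ?_⟩, hderiv⟩
  · rw [contDiff_infty_iff_deriv, hderiv]
    exact ⟨fun t => (hd t).differentiableAt, h.1⟩
  · exact HasCompactSupport.intro isCompact_Icc hsupp
  · refine (closure_minimal (fun t ht => ?_) isClosed_Icc).trans (Icc_subset_Ioo ha hb)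
    by_contra h'
    exact ht (hsupp t h')

theorem IsTestFunction.exists_integral_eq_one (hT : 0 < T) :
    ∃ φ, IsTestFunction T φ ∧ ∫ t, φ t ∂(timeMeasure T) = 1 := by
  -- The outer radius `T/4` keeps the support in `[T/4, 3T/4]`.
  let b : ContDiffBump (T / 2) := ⟨T / 8, T / 4, by positivity, by linarith⟩
  have hs : tsupport (b.normed volume) ⊆ Ioo 0 T := by
    rw [b.tsupport_normed_eq, Real.closedBall_eq_Icc]
    exact Icc_subset_Ioo (by simp only [b]; linarith) (by simp only [b]; linarith)
  refine ⟨b.normed volume, ⟨b.contDiff_normed, b.hasCompactSupport_normed, hs⟩, ?_⟩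
  rw [setIntegral_eq_integral_of_forall_compl_eq_zero, b.integral_normed]
  exact fun t ht => image_eq_zero_of_notMem_tsupport fun h' => ht (hs h')

/-- The lemma of du Bois-Reymond. -/
theorem IsWeakTimeDeriv.exists_eq_const [CompleteSpace X] (hT : 0 < T) {f : L2Time T X}
    (h : IsWeakTimeDeriv T f 0) : ∃ c : X, f =ᵐ[timeMeasure T] fun _ => c := by
  obtain ⟨ψ, hψ, hψ1⟩ := IsTestFunction.exists_integral_eq_one hT
  have hi : ∀ {φ}, IsTestFunction T φ → Integrable φ (timeMeasure T) := fun hφ =>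
    memLp_one_iff_integrable.1 (hφ.1.continuous.memLp_timeMeasure T 1)
  refine ⟨∫ t, ψ t • f t ∂(timeMeasure T), ?_⟩
  set c := ∫ t, ψ t • f t ∂(timeMeasure T)
  have key := isOpen_Ioo.ae_eq_zero_of_integral_contDiff_smul_eq_zero (U := Ioo 0 T)
    (μ := timeMeasure T) (f := fun t => f t - c)
    ((f.integrable.sub (integrable_const c)).locallyIntegrable.locallyIntegrableOn _) (by
      intro φ h1 h2 h3
      have hφ : IsTestFunction T φ := ⟨h1, h2, h3⟩
      set m := ∫ t, φ t ∂(timeMeasure T)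
      -- Subtracting `m ψ` makes the mean zero, so the difference is the derivative of a test
      -- function and integrates to zero against `f`. This says precisely that `∫ φ (f - c) = 0`.
      have hχ : IsTestFunction T (fun t => φ t - m * ψ t) :=
        ⟨h1.sub (contDiff_const.mul hψ.1), h2.sub hψ.2.1.mul_left,
          (tsupport_sub _ _).trans (union_subset h3 ((tsupport_mul_subset_right).trans hψ.2.2))⟩
      obtain ⟨χ, hχt, hχd⟩ := hχ.exists_primitive hT (by
        rw [integral_sub (hi hφ) ((hi hψ).const_mul m), integral_const_mul, hψ1, mul_one, sub_self])
      have h5 := h χ hχt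
      have h6 : ∫ t, χ t • (0 : L2Time T X) t ∂(timeMeasure T) = 0 := by
        refine integral_eq_zero_of_ae ?_
        filter_upwards [Lp.coeFn_zero X 2 (timeMeasure T)] with t ht
        exact (congrArg (χ t • ·) ht).trans (smul_zero _)
      rw [h6, neg_zero, hχd] at h5
      simp only [sub_smul, mul_smul] at h5
      rw [integral_sub (hφ.integrable_smul f) ((hψ.integrable_smul f).fun_smul m),
        integral_smul] at h5
      simp only [smul_sub]
      rw [integral_sub (hφ.integrable_smul f) ((hi hφ).smul_const c), integral_smul_const]
      exact h5)
  filter_upwards [key, ae_restrict_mem measurableSet_Ioo] with t ht hm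
  exact sub_eq_zero.1 (ht hm)

/-- `C¹` functions are dense in `H¹(0,T;X)`. -/
theorem IsWeakTimeDeriv.exists_contDiff_approx [CompleteSpace X] (hT : 0 < T) {f g : L2Time T X}
    (h : IsWeakTimeDeriv T f g) {ε : ℝ} (hε : 0 < ε) :
    ∃ (w w' : ℝ → X) (_ : ∀ t, HasDerivAt w (w' t) t) (hw' : Continuous w') (hw : Continuous w),
      ‖continuousToL2 T w hw - f‖ < ε ∧ ‖continuousToL2 T w' hw' - g‖ < ε := by
  -- By du Bois-Reymond `f` is a constant plus the primitive of `g`, so it suffices to approximate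
  -- `g` by a continuous `k` and integrate.
  have h0 : IsWeakTimeDeriv T (f - L2Time.primitive T X g) 0 := by
    have := h.add ((L2Time.isWeakTimeDeriv_primitive hT.le g).smul (-1))
    simpa [sub_eq_add_neg] using this
  obtain ⟨c, hc⟩ := h0.exists_eq_const hT
  set K := ‖L2Time.primitive T X‖ + 1
  have hK : 0 < K := by positivity
  -- The bound `ε / K` absorbs the norm of the primitive operator; the bound `ε` serves the
  -- derivative itself.
  obtain ⟨k, hk, hkg⟩ := continuousToL2_approx T g (ε := min ε (ε / K)) (by positivity)
  have hd : ∀ t, HasDerivAt (fun t => (∫ s in (0 : ℝ)..t, k s) + c) (k t) t := fun t =>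
    (hasDerivAt_primitive hk t).add_const c
  have hw : Continuous (fun t => (∫ s in (0 : ℝ)..t, k s) + c) :=
    (continuous_integral_primitive hk).add continuous_const
  refine ⟨_, k, hd, hk, hw, ?_, hkg.trans_le (min_le_left _ _)⟩
  have e : continuousToL2 T _ hw - f = L2Time.primitive T X (continuousToL2 T k hk - g) := by
    rw [map_sub, L2Time.primitive_continuousToL2]
    refine Lp.ext ?_
    filter_upwards [hc, Lp.coeFn_sub f (L2Time.primitive T X g),
      Lp.coeFn_sub (continuousToL2 T _ hw) f, Lp.coeFn_sub
        (continuousToL2 T _ (continuous_integral_primitive hk)) (L2Time.primitive T X g),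
      coeFn_continuousToL2 T hw, coeFn_continuousToL2 T (continuous_integral_primitive hk)]
        with t h₁ h₂ h₃ h₄ h₅ h₆
    rw [h₂, Pi.sub_apply] at h₁
    rw [h₃, h₄, Pi.sub_apply, Pi.sub_apply, h₅, h₆, ← h₁]
    abel
  rw [e]
  calc _ ≤ ‖L2Time.primitive T X‖ * ‖continuousToL2 T k hk - g‖ := ContinuousLinearMap.le_opNorm _ _
    _ ≤ K * ‖continuousToL2 T k hk - g‖ := by gcongr; simp [K]
    _ < K * (ε / K) := by gcongr; exact hkg.trans_le (min_le_right _ _)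
    _ = ε := by field_simp

end WeakTimeDerivative

/-! ### Resolvents of positive operators -/

section Regularization

open Filter Topology

variable {X : Type*} [NormedAddCommGroup X] [InnerProductSpace ℝ X]

/-- Pairing the resolvent equation with `z` and dropping `⟪G z, z⟫ ≥ 0` leaves `ε‖z‖² ≤ ⟪x, z⟫`. -/
theorem norm_smul_resolvent_le {G : X →L[ℝ] X} (hpos : ∀ x, 0 ≤ ⟪G x, x⟫) {ε : ℝ} (hε : 0 < ε)
    {x z : X} (hz : G z + ε • z = x) : ‖ε • z‖ ≤ ‖x‖ := by
  rcases eq_or_ne z 0 with rfl | h0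
  · simp
  have h0' : 0 < ‖z‖ := norm_pos_iff.2 h0
  have h1 : ⟪x, z⟫ = ⟪G z, z⟫ + ε * ‖z‖ ^ 2 := by
    rw [← hz, inner_add_left, real_inner_smul_left, real_inner_self_eq_norm_sq]
  have h2 := real_inner_le_norm x z
  have h3 := hpos z
  rw [norm_smul, Real.norm_of_nonneg hε.le]
  refine le_of_mul_le_mul_right ?_ h0'
  nlinarith

/-- Strong convergence of the Yosida regularization `(G + ε)⁻¹ G → 1` for a positive, injective,
symmetric operator. -/
theorem tendsto_smul_resolvent [CompleteSpace X] {G : X →L[ℝ] X}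
    (hsymm : ∀ x y, ⟪G x, y⟫ = ⟪x, G y⟫) (hpos : ∀ x, 0 ≤ ⟪G x, x⟫)
    (hinj : Function.Injective G) {q : ℝ → X →L[ℝ] X}
    (hq : ∀ ε > 0, ∀ x, G (q ε x) + ε • q ε x = x)
    (hq' : ∀ ε > 0, ∀ x, q ε (G x) + ε • q ε x = x) (x : X) :
    Tendsto (fun ε => ε • q ε x) (𝓝[>] 0) (𝓝 0) := by
  -- By symmetry the orthogonal complement of the range is the kernel, which is trivial.
  have hdense : Dense (G.range : Set X) := by
    rw [Submodule.dense_iff_topologicalClosure_eq_top, Submodule.topologicalClosure_eq_top_iff,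
      Submodule.eq_bot_iff]
    intro y hy
    refine hinj ?_
    rw [map_zero, ← inner_self_eq_zero (𝕜 := ℝ), hsymm]
    exact (real_inner_comm _ _).trans (hy _ ⟨G y, rfl⟩)
  rw [Metric.tendsto_nhds]
  intro δ hδ
  obtain ⟨_, ⟨a, rfl⟩, ha⟩ := hdense.exists_dist_lt x (half_pos hδ)
  rw [ContinuousLinearMap.coe_coe, dist_eq_norm] at ha
  have hev : ∀ᶠ ε : ℝ in 𝓝[>] 0, ε * (2 * ‖a‖) < δ / 2 := by
    have : Tendsto (fun ε : ℝ => ε * (2 * ‖a‖)) (𝓝[>] 0) (𝓝 (0 * (2 * ‖a‖))) :=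
      (tendsto_id.mul_const _).mono_left nhdsWithin_le_nhds
    rw [zero_mul] at this
    exact this.eventually_lt_const (half_pos hδ)
  filter_upwards [hev, self_mem_nhdsWithin] with ε h1 hε
  have hε : 0 < ε := hε
  have h2 : ‖ε • q ε (x - G a)‖ ≤ ‖x - G a‖ := norm_smul_resolvent_le hpos hε (hq ε hε _)
  -- On the range of `G` the resolvent stays bounded as `ε → 0`, so `ε • q ε (G a)` is of order `ε`;
  -- the uniform contraction bound handles the remainder `x - G a`.
  have h3 : ‖q ε (G a)‖ ≤ 2 * ‖a‖ := by
    have h4 : q ε (G a) = a - ε • q ε a := eq_sub_of_add_eq (hq' ε hε a)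
    rw [h4]
    have h5 : ‖ε • q ε a‖ ≤ ‖a‖ := norm_smul_resolvent_le hpos hε (hq ε hε _)
    linarith [norm_sub_le a (ε • q ε a)]
  have h6 : ε • q ε x = ε • q ε (x - G a) + ε • q ε (G a) := by
    rw [← smul_add, ← map_add, sub_add_cancel]
  rw [dist_zero_right, h6]
  calc _ ≤ ‖ε • q ε (x - G a)‖ + ‖ε • q ε (G a)‖ := norm_add_le _ _
    _ ≤ ‖x - G a‖ + ε * (2 * ‖a‖) := by
      gcongr
      rw [norm_smul, Real.norm_of_nonneg hε.le]
      gcongr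
    _ < δ := by linarith

/-- Lax–Milgram: the form of `G + ε` is coercive with constant `ε`. It serves twice, in the
regularisation of `W(0,T)` and in solving the optimality equation. -/
theorem exists_resolvent [CompleteSpace X] {G : X →L[ℝ] X} (hpos : ∀ x, 0 ≤ ⟪G x, x⟫) {ε : ℝ}
    (hε : 0 < ε) :
    ∃ q : X →L[ℝ] X, (∀ x, G (q x) + ε • q x = x) ∧ ∀ x, q (G x) + ε • q x = x := by
  let B : X →L[ℝ] X →L[ℝ] ℝ :=
    (isBoundedBilinearMap_inner (𝕜 := ℝ) (E := X)).toContinuousLinearMap ∘L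
      (G + ε • ContinuousLinearMap.id ℝ X)
  have hB : ∀ v w, B v w = ⟪G v + ε • v, w⟫ := fun _ _ => rfl
  have hc : IsCoercive B := by
    refine ⟨ε, hε, fun u => ?_⟩
    rw [hB, inner_add_left, real_inner_smul_left, real_inner_self_eq_norm_sq]
    nlinarith [hpos u]
  have he : ∀ v, hc.continuousLinearEquivOfBilin v = G v + ε • v := fun v =>
    ext_inner_right ℝ fun w => by rw [hc.continuousLinearEquivOfBilin_apply, hB]
  refine ⟨hc.continuousLinearEquivOfBilin.symm, fun x => ?_, fun x => ?_⟩
  · rw [← he]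
    exact hc.continuousLinearEquivOfBilin.apply_symm_apply x
  · rw [← map_smul, ← map_add, ← he]
    exact hc.continuousLinearEquivOfBilin.symm_apply_apply x

end Regularization

/-! ### The space of `C¹` functions -/

section SmoothFunctions

/-- The sum enters through an equation because it is also needed for the derivative of a sum, which
equals the sum of derivatives only propositionally. -/
theorem continuousToL2_add {X : Type*} [NormedAddCommGroup X] {T : ℝ} {w v : ℝ → X}
    (hw : Continuous w) (hv : Continuous v)
    {s : ℝ → X} (hs : Continuous s) (h : s = w + v) :
    continuousToL2 T s hs = continuousToL2 T w hw + continuousToL2 T v hv := by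
  subst h; rfl

variable {X : Type*} [NormedAddCommGroup X] [NormedSpace ℝ X] {T : ℝ}

theorem continuousToL2_smul (c : ℝ) {w : ℝ → X} (hw : Continuous w)
    {s : ℝ → X} (hs : Continuous s) (h : s = c • w) :
    continuousToL2 T s hs = c • continuousToL2 T w hw := by
  subst h; rfl

theorem compLpL_continuousToL2 {Y : Type*} [NormedAddCommGroup Y] [NormedSpace ℝ Y]
    (L : X →L[ℝ] Y) {w : ℝ → X} (hw : Continuous w) :
    L.compLpL 2 (timeMeasure T) (continuousToL2 T w hw)
      = continuousToL2 T (fun t => L (w t)) (L.continuous.comp hw) := by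
  refine Lp.ext ?_
  filter_upwards [L.coeFn_compLpL (continuousToL2 T w hw), coeFn_continuousToL2 T hw,
    coeFn_continuousToL2 T (L.continuous.comp hw)] with t h₁ h₂ h₃
  rw [h₁, h₂]
  exact h₃.symm

/-- The space of continuously differentiable functions. -/
def smoothFunctions (X : Type*) [NormedAddCommGroup X] [NormedSpace ℝ X] :
    Submodule ℝ (ℝ → X) where
  carrier := {w | ContDiff ℝ 1 w}
  zero_mem' := by
    change ContDiff ℝ 1 fun _ => (0 : X)
    exact contDiff_const
  add_mem' := by
    intro w v hw hv
    change ContDiff ℝ 1 w at hw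
    change ContDiff ℝ 1 v at hv
    exact hw.add hv
  smul_mem' := by
    intro c w hw
    change ContDiff ℝ 1 w at hw
    exact hw.const_smul c

namespace smoothFunctions

theorem contDiff (w : smoothFunctions X) : ContDiff ℝ 1 w.1 := w.2

theorem continuous (w : smoothFunctions X) : Continuous w.1 := (contDiff w).continuous

theorem continuous_deriv (w : smoothFunctions X) : Continuous (deriv w.1) :=
  (contDiff w).continuous_deriv le_rfl

theorem hasDerivAt (w : smoothFunctions X) (t : ℝ) : HasDerivAt w.1 (deriv w.1 t) t :=
  ((contDiff w).differentiable (by simp) t).hasDerivAt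

end smoothFunctions

end SmoothFunctions

/-! ### Structure of `W(0,T)` and density of smooth functions -/

section GelfandTriple

variable {V H : Type*} [NormedAddCommGroup V] [InnerProductSpace ℝ V]
  [NormedAddCommGroup H] [InnerProductSpace ℝ H] {T : ℝ} {ι : V →L[ℝ] H}

/-- The Riesz isomorphism `V ≅ V'`. -/
def riesz (V : Type*) [NormedAddCommGroup V] [InnerProductSpace ℝ V] [CompleteSpace V] :
    V ≃ₗᵢ[ℝ] StrongDual ℝ V where
  toFun := InnerProductSpace.toDual ℝ V
  map_add' := map_add _
  map_smul' := by intro c x; simp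
  invFun := (InnerProductSpace.toDual ℝ V).symm
  left_inv := (InnerProductSpace.toDual ℝ V).symm_apply_apply
  right_inv := (InnerProductSpace.toDual ℝ V).apply_symm_apply
  norm_map' := (InnerProductSpace.toDual ℝ V).norm_map

theorem riesz_apply [CompleteSpace V] (v w : V) : riesz V v w = ⟪v, w⟫ := rfl

theorem inner_riesz_symm [CompleteSpace V] (f : StrongDual ℝ V) (v : V) :
    ⟪(riesz V).symm f, v⟫ = f v := by
  rw [← riesz_apply, LinearIsometryEquiv.apply_symm_apply]

namespace StateSpace

theorem isWeakTimeDeriv (y : StateSpace T ι) :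
    IsWeakTimeDeriv T ((toDualV ι).compLpL 2 (timeMeasure T) (toL2 T ι y)) (timeDeriv T ι y) :=
  y.2

/-- The element of `W(0,T)` with given state and weak derivative. -/
def mk (f : L2Time T V) (g : L2Time T (StrongDual ℝ V))
    (h : IsWeakTimeDeriv T ((toDualV ι).compLpL 2 (timeMeasure T) f) g) : StateSpace T ι :=
  ⟨WithLp.toLp 2 (f, g), h⟩

@[simp] theorem toL2_mk {f : L2Time T V} {g : L2Time T (StrongDual ℝ V)}
    (h : IsWeakTimeDeriv T ((toDualV ι).compLpL 2 (timeMeasure T) f) g) :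
    toL2 T ι (mk f g h) = f := rfl

@[simp] theorem timeDeriv_mk {f : L2Time T V} {g : L2Time T (StrongDual ℝ V)}
    (h : IsWeakTimeDeriv T ((toDualV ι).compLpL 2 (timeMeasure T) f) g) :
    timeDeriv T ι (mk f g h) = g := rfl

theorem ext {y z : StateSpace T ι} (h₁ : toL2 T ι y = toL2 T ι z)
    (h₂ : timeDeriv T ι y = timeDeriv T ι z) : y = z :=
  Subtype.ext ((WithLp.ofLp_injective 2) (Prod.ext h₁ h₂))

theorem norm_sq_eq (y : StateSpace T ι) :
    ‖y‖ ^ 2 = ‖toL2 T ι y‖ ^ 2 + ‖timeDeriv T ι y‖ ^ 2 :=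
  WithLp.prod_norm_sq_eq_of_L2 y.1

theorem norm_le_add (y : StateSpace T ι) : ‖y‖ ≤ ‖toL2 T ι y‖ + ‖timeDeriv T ι y‖ := by
  refine le_of_sq_le_sq ?_ (by positivity)
  rw [norm_sq_eq]
  nlinarith [norm_nonneg (toL2 T ι y), norm_nonneg (timeDeriv T ι y)]

theorem norm_toL2_le (y : StateSpace T ι) : ‖toL2 T ι y‖ ≤ ‖y‖ := by
  refine le_of_sq_le_sq ?_ (by positivity)
  rw [norm_sq_eq]
  nlinarith [norm_nonneg (timeDeriv T ι y)]

instance [CompleteSpace V] : CompleteSpace (StateSpace T ι) := by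
  refine IsComplete.completeSpace_coe (IsClosed.isComplete ?_)
  exact isClosed_setOf_isWeakTimeDeriv
    (((toDualV ι).compLpL 2 (timeMeasure T)).continuous.comp
      (WithLp.fstL 2 ℝ (L2Time T V) (L2Time T (StrongDual ℝ V))).continuous)
    (WithLp.sndL 2 ℝ (L2Time T V) (L2Time T (StrongDual ℝ V))).continuous

theorem isWeakTimeDeriv_smooth [CompleteSpace V] (hT : 0 ≤ T) (w : smoothFunctions V) :
    IsWeakTimeDeriv T ((toDualV ι).compLpL 2 (timeMeasure T)
      (continuousToL2 T w.1 (smoothFunctions.continuous w)))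
      ((toDualV ι).compLpL 2 (timeMeasure T)
        (continuousToL2 T (deriv w.1) (smoothFunctions.continuous_deriv w))) :=
  (isWeakTimeDeriv_continuousToL2 hT (smoothFunctions.hasDerivAt w)
    (smoothFunctions.continuous_deriv w) (smoothFunctions.continuous w)).map _

/-- Continuously differentiable functions as elements of `W(0,T)`. -/
def ofSmooth [CompleteSpace V] (ι : V →L[ℝ] H) (hT : 0 ≤ T) :
    smoothFunctions V →ₗ[ℝ] StateSpace T ι where
  toFun w := mk _ _ (isWeakTimeDeriv_smooth hT w)
  map_add' w v := by
    refine StateSpace.ext ?_ ?_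
    · exact continuousToL2_add (smoothFunctions.continuous w) (smoothFunctions.continuous v)
        (smoothFunctions.continuous (w + v)) rfl
    · rw [map_add, timeDeriv_mk, timeDeriv_mk, timeDeriv_mk, ← map_add]
      congr 1
      exact continuousToL2_add _ _ _ (funext fun t =>
        ((smoothFunctions.hasDerivAt w t).add (smoothFunctions.hasDerivAt v t)).deriv)
  map_smul' c w := by
    refine StateSpace.ext ?_ ?_
    · exact continuousToL2_smul c (smoothFunctions.continuous w)
        (smoothFunctions.continuous (c • w)) rfl
    · rw [RingHom.id_apply, map_smul, timeDeriv_mk, timeDeriv_mk, ← map_smul]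
      congr 1
      exact continuousToL2_smul c _ _ (funext fun t =>
        ((smoothFunctions.hasDerivAt w t).const_smul c).deriv)

theorem toL2_ofSmooth [CompleteSpace V] (hT : 0 ≤ T) (w : smoothFunctions V) :
    toL2 T ι (ofSmooth ι hT w) = continuousToL2 T w.1 (smoothFunctions.continuous w) := rfl

theorem timeDeriv_ofSmooth [CompleteSpace V] (hT : 0 ≤ T) (w : smoothFunctions V) :
    timeDeriv T ι (ofSmooth ι hT w) = (toDualV ι).compLpL 2 (timeMeasure T)
      (continuousToL2 T (deriv w.1) (smoothFunctions.continuous_deriv w)) := rfl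

/-- Continuously differentiable functions with values in `V` are dense in `W(0,T)`. -/
theorem denseRange_ofSmooth [CompleteSpace V] [CompleteSpace H] (hι : Function.Injective ι)
    (hT : 0 < T) : DenseRange (ofSmooth (T := T) ι hT.le) := by
  -- Pulling the embedding `V → V'` back by Riesz gives a positive, symmetric, injective operator on
  -- `V`, to which the resolvent results apply.
  let G : V →L[ℝ] V := (riesz V).symm.toContinuousLinearEquiv.toContinuousLinearMap ∘L toDualV ι
  have hG : ∀ v w, ⟪G v, w⟫ = ⟪ι v, ι w⟫ := fun v w => inner_riesz_symm _ _
  have hsymm : ∀ v w, ⟪G v, w⟫ = ⟪v, G w⟫ := fun v w => by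
    rw [real_inner_comm _ v, hG, hG, real_inner_comm]
  have hpos : ∀ v, 0 ≤ ⟪G v, v⟫ := fun v => by rw [hG]; exact real_inner_self_nonneg
  have hinj : ∀ v, G v = 0 → v = 0 := fun v hv => by
    have := hG v v
    rw [hv, inner_zero_left, eq_comm, inner_self_eq_zero] at this
    exact hι (this.trans (map_zero ι).symm)
  have hex : ∀ ε : ℝ, ∃ q : V →L[ℝ] V, 0 < ε →
      (∀ x, G (q x) + ε • q x = x) ∧ ∀ x, q (G x) + ε • q x = x := fun ε => by
    by_cases hε : 0 < ε
    · obtain ⟨q, hq⟩ := exists_resolvent hpos hε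
      exact ⟨q, fun _ => hq⟩
    · exact ⟨0, fun h => absurd h hε⟩
  choose q hq using hex
  let m : (V →L[ℝ] V) → (L2Time T V →L[ℝ] L2Time T V) := fun L => L.compLpL 2 (timeMeasure T)
  have hm : ∀ (L : V →L[ℝ] V) (f : L2Time T V), m L f =ᵐ[timeMeasure T] fun t => L (f t) :=
    fun L f => L.coeFn_compLpL f
  have h₁ : ∀ ε > 0, ∀ f, m G (m (q ε) f) + ε • m (q ε) f = f := fun ε hε f => by
    refine Lp.ext ?_
    filter_upwards [hm G (m (q ε) f), hm (q ε) f, Lp.coeFn_add (m G (m (q ε) f)) (ε • m (q ε) f),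
      Lp.coeFn_smul ε (m (q ε) f)] with t a₁ a₂ a₃ a₄
    rw [a₃, Pi.add_apply, a₄, Pi.smul_apply, a₁, a₂, (hq ε hε).1]
  have h₂ : ∀ ε > 0, ∀ f, m (q ε) (m G f) + ε • m (q ε) f = f := fun ε hε f => by
    refine Lp.ext ?_
    filter_upwards [hm (q ε) (m G f), hm (q ε) f, Lp.coeFn_add (m (q ε) (m G f)) (ε • m (q ε) f),
      Lp.coeFn_smul ε (m (q ε) f), hm G f] with t a₁ a₂ a₃ a₄ a₅
    rw [a₃, Pi.add_apply, a₄, Pi.smul_apply, a₁, a₂, a₅, (hq ε hε).2]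
  -- The resolvent identities hold pointwise in time, so the strong convergence can be applied
  -- directly in the Hilbert space `L²(0,T;V)`.
  have htend := tendsto_smul_resolvent (G := m G) (q := fun ε => m (q ε)) (fun f g => by
      rw [L2.inner_def, L2.inner_def]
      refine integral_congr_ae ?_
      filter_upwards [hm G f, hm G g] with t a₁ a₂
      rw [a₁, a₂, hsymm]) (fun f => by
      rw [L2.inner_def]
      refine integral_nonneg_of_ae ?_
      filter_upwards [hm G f] with t a₁
      rw [a₁]
      exact hpos _) ((injective_iff_map_eq_zero _).2 fun f hf => by
      refine Lp.ext ?_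
      filter_upwards [hm G f, Lp.coeFn_zero V 2 (timeMeasure T)] with t a₁ a₂
      rw [a₂]
      refine hinj _ ?_
      rw [← a₁, hf, a₂, Pi.zero_apply]) h₁ h₂
  refine Metric.denseRange_iff.2 fun y δ hδ => ?_
  set f := toL2 T ι y
  set g := timeDeriv T ι y
  let R : StrongDual ℝ V →L[ℝ] V := (riesz V).symm.toContinuousLinearEquiv.toContinuousLinearMap
  let r : L2Time T V := R.compLpL 2 (timeMeasure T) g
  have e₁ := (Metric.tendsto_nhds.1 (htend f)) (δ / 4) (by positivity)
  have e₂ := (Metric.tendsto_nhds.1 (htend r)) (δ / 4) (by positivity)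
  obtain ⟨ε, ⟨hεf, hεr⟩, hε⟩ := ((e₁.and e₂).and self_mem_nhdsWithin).exists
  have hε : 0 < ε := hε
  rw [dist_zero_right] at hεf hεr
  -- Applying `q ε ∘L R : V' → V` to `y` and `y'` gives `f - ε q_ε f` with weak derivative `q_ε r`,
  -- both valued in `V`. Approximation by `C¹` functions is then available.
  have hweak := (isWeakTimeDeriv y).map (q ε ∘L R)
  have c₁ : (q ε ∘L R).compLpL 2 (timeMeasure T) ((toDualV ι).compLpL 2 (timeMeasure T) f)
      = f - ε • m (q ε) f := by
    rw [← eq_sub_of_add_eq (h₂ ε hε f)]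
    refine Lp.ext ?_
    filter_upwards [(q ε ∘L R).coeFn_compLpL ((toDualV ι).compLpL 2 (timeMeasure T) f),
      (toDualV ι).coeFn_compLpL f, hm (q ε) (m G f), hm G f] with t a₁ a₂ a₃ a₄
    rw [a₁, a₂, a₃, a₄]
    rfl
  have c₂ : (q ε ∘L R).compLpL 2 (timeMeasure T) g = m (q ε) r := by
    refine Lp.ext ?_
    filter_upwards [(q ε ∘L R).coeFn_compLpL g, R.coeFn_compLpL g, hm (q ε) r] with t a₁ a₂ a₃
    rw [a₁, a₃, a₂]
    rfl
  rw [c₁, c₂] at hweak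
  set D := (toDualV ι).compLpL 2 (timeMeasure T)
  set K := ‖D‖ + 1
  have hK : 0 < K := by positivity
  obtain ⟨w, w', hd, hw', hw, k₁, k₂⟩ :=
    hweak.exists_contDiff_approx hT (ε := min (δ / 4) (δ / 4 / K)) (by positivity)
  have hw'e : deriv w = w' := funext fun t => (hd t).deriv
  have hwC : ContDiff ℝ 1 w := contDiff_one_iff_deriv.2
    ⟨fun t => (hd t).differentiableAt, hw'e ▸ hw'⟩
  refine ⟨⟨w, hwC⟩, ?_⟩
  rw [dist_comm, dist_eq_norm]
  have b₁ : ‖toL2 T ι (ofSmooth ι hT.le ⟨w, hwC⟩ - y)‖ < δ / 2 := by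
    rw [map_sub, toL2_ofSmooth]
    have := norm_sub_le (continuousToL2 T w hw - (f - ε • m (q ε) f)) (ε • m (q ε) f)
    rw [sub_sub, sub_add_cancel] at this
    linarith [min_le_left (δ / 4) (δ / 4 / K)]
  have b₂ : ‖timeDeriv T ι (ofSmooth ι hT.le ⟨w, hwC⟩ - y)‖ < δ / 2 := by
    rw [map_sub, timeDeriv_ofSmooth]
    -- The Riesz isometry turns the error in `V'` into `G q_ε r - r = -ε q_ε r`, which is already
    -- known to be small.
    have h : ‖D (m (q ε) r) - g‖ = ‖ε • m (q ε) r‖ := by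
      rw [show ε • m (q ε) r = r - m G (m (q ε) r) from
        eq_sub_of_add_eq' (h₁ ε hε r), norm_sub_rev r, Lp.norm_def, Lp.norm_def]
      congr 1
      refine eLpNorm_congr_norm_ae ?_
      filter_upwards [hm G (m (q ε) r), Lp.coeFn_sub (m G (m (q ε) r)) r,
        Lp.coeFn_sub (D (m (q ε) r)) g, (toDualV ι).coeFn_compLpL (m (q ε) r),
        R.coeFn_compLpL g] with t a₁ a₂ a₃ a₄ a₅
      rw [a₂, a₃, Pi.sub_apply, Pi.sub_apply, a₁, a₄, a₅]
      exact ((riesz V).symm.norm_map _).symm.trans (by rw [map_sub]; rfl)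
    have h' : ‖D (continuousToL2 T w' hw' - m (q ε) r)‖ < δ / 4 := by
      calc _ ≤ ‖D‖ * ‖continuousToL2 T w' hw' - m (q ε) r‖ := ContinuousLinearMap.le_opNorm _ _
        _ ≤ K * ‖continuousToL2 T w' hw' - m (q ε) r‖ := by gcongr; simp [K]
        _ < K * (δ / 4 / K) := by gcongr; exact k₂.trans_le (min_le_right _ _)
        _ = δ / 4 := by field_simp
    have h'' : D (continuousToL2 T (deriv w) (hw'e ▸ hw')) - g
        = D (continuousToL2 T w' hw' - m (q ε) r) + (D (m (q ε) r) - g) := by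
      subst hw'e
      rw [map_sub, sub_add_sub_cancel]
    change ‖D (continuousToL2 T (deriv w) (hw'e ▸ hw')) - g‖ < δ / 2
    rw [h'']
    linarith [norm_add_le (D (continuousToL2 T w' hw' - m (q ε) r)) (D (m (q ε) r) - g)]
  linarith [norm_le_add (ofSmooth ι hT.le ⟨w, hwC⟩ - y)]

end StateSpace

end GelfandTriple

/-! ### Continuous representatives and integration by parts -/

section Trace

/-- Since `X` need not carry an inner product, the identity is read off from the scalar function `t
↦ ‖f t‖`. -/
theorem L2Time.norm_sq_eq {T : ℝ} {X : Type*} [NormedAddCommGroup X] (f : L2Time T X) :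
    ‖f‖ ^ 2 = ∫ t, ‖f t‖ ^ 2 ∂(timeMeasure T) := by
  have h : ‖(Lp.memLp f).norm.toLp‖ = ‖f‖ := by
    rw [Lp.norm_toLp, eLpNorm_norm, Lp.norm_def]
  rw [← h, ← real_inner_self_eq_norm_sq, L2.inner_def]
  refine integral_congr_ae ?_
  filter_upwards [(Lp.memLp f).norm.coeFn_toLp] with t ht
  rw [ht, real_inner_self_eq_norm_sq, Real.norm_of_nonneg (norm_nonneg _)]

theorem L2Time.integrable_norm_sq {T : ℝ} {X : Type*} [NormedAddCommGroup X] (f : L2Time T X) :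
    Integrable (fun t => ‖f t‖ ^ 2) (timeMeasure T) :=
  (Lp.memLp f).integrable_norm_pow (by norm_num)

theorem integral_norm_sq_continuousToL2 {T : ℝ} {X : Type*} [NormedAddCommGroup X] {w : ℝ → X}
    (hw : Continuous w) :
    ∫ t, ‖w t‖ ^ 2 ∂(timeMeasure T) = ‖continuousToL2 T w hw‖ ^ 2 := by
  rw [L2Time.norm_sq_eq]
  refine integral_congr_ae ?_
  filter_upwards [coeFn_continuousToL2 T hw] with t ht
  rw [ht]

variable {V H : Type*} [NormedAddCommGroup V] [InnerProductSpace ℝ V]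
  [NormedAddCommGroup H] [InnerProductSpace ℝ H] {T : ℝ} {ι : V →L[ℝ] H}

/-- The duality pairing of `L²(0,T;V')` and `L²(0,T;V)`. -/
def dualPairing (T : ℝ) (V : Type*) [NormedAddCommGroup V] [InnerProductSpace ℝ V] :
    L2Time T (StrongDual ℝ V) →L[ℝ] L2Time T V →L[ℝ] ℝ :=
  (ContinuousLinearMap.id ℝ (StrongDual ℝ V)).lpPairing (timeMeasure T) 2 2

theorem dualPairing_apply (f : L2Time T (StrongDual ℝ V)) (g : L2Time T V) :
    dualPairing T V f g = ∫ t, f t (g t) ∂(timeMeasure T) :=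
  ContinuousLinearMap.lpPairing_eq_integral _ _ _

theorem integrable_dual_apply (f : L2Time T (StrongDual ℝ V)) (g : L2Time T V) :
    Integrable (fun t => f t (g t)) (timeMeasure T) :=
  memLp_one_iff_integrable.1 ((ContinuousLinearMap.id ℝ (StrongDual ℝ V)).memLp_of_bilin 1
    (Lp.memLp f) (Lp.memLp g))

open StateSpace

theorem hasDerivAt_inner_smooth (ι : V →L[ℝ] H) (w v : smoothFunctions V) (t : ℝ) :
    HasDerivAt (fun t => ⟪ι (w.1 t), ι (v.1 t)⟫)
      (toDualV ι (deriv w.1 t) (v.1 t) + toDualV ι (deriv v.1 t) (w.1 t)) t := by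
  have h := (ι.hasFDerivAt.comp_hasDerivAt t (smoothFunctions.hasDerivAt w t)).inner ℝ
    (ι.hasFDerivAt.comp_hasDerivAt t (smoothFunctions.hasDerivAt v t))
  refine h.congr_deriv ?_
  change ⟪ι (w.1 t), ι (deriv v.1 t)⟫ + ⟪ι (deriv w.1 t), ι (v.1 t)⟫
    = ⟪ι (deriv w.1 t), ι (v.1 t)⟫ + ⟪ι (deriv v.1 t), ι (w.1 t)⟫
  rw [real_inner_comm (ι (w.1 t)), add_comm]

theorem continuous_toDualV_smooth (ι : V →L[ℝ] H) (w v : smoothFunctions V) :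
    Continuous fun t => toDualV ι (deriv w.1 t) (v.1 t) :=
  ((toDualV ι).continuous.comp (smoothFunctions.continuous_deriv w)).clm_apply
    (smoothFunctions.continuous v)

theorem integral_inner_smooth (ι : V →L[ℝ] H) (w v : smoothFunctions V) (s t : ℝ) :
    ∫ r in s..t, (toDualV ι (deriv w.1 r) (v.1 r) + toDualV ι (deriv v.1 r) (w.1 r))
      = ⟪ι (w.1 t), ι (v.1 t)⟫ - ⟪ι (w.1 s), ι (v.1 s)⟫ :=
  intervalIntegral.integral_eq_sub_of_hasDerivAt (fun r _ => hasDerivAt_inner_smooth ι w v r)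
    (((continuous_toDualV_smooth ι w v).add (continuous_toDualV_smooth ι v w)).intervalIntegrable
      _ _)

/-- This bound carries the embedding `W(0,T) → C([0,T];H)`. From `|w(t)|² - |w(s)|² = 2∫⟨w', w⟩ ≤
∫(‖w‖² + ‖w'‖²)`, averaging over `s` replaces the unknown `|w(s)|²` by `‖ι‖²/T` times an `L²` norm.
-/
theorem norm_sq_smooth_le [CompleteSpace V] (hT : 0 < T) (w : smoothFunctions V) {t : ℝ}
    (ht : t ∈ Icc 0 T) :
    ‖ι (w.1 t)‖ ^ 2 ≤ (‖ι‖ ^ 2 / T + 1) * ‖ofSmooth ι hT.le w‖ ^ 2 := by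
  set D : ℝ → StrongDual ℝ V := fun r => toDualV ι (deriv w.1 r)
  have hw := smoothFunctions.continuous w
  have hD : Continuous D := (toDualV ι).continuous.comp (smoothFunctions.continuous_deriv w)
  have hN : ‖ofSmooth ι hT.le w‖ ^ 2
      = ∫ r, (‖w.1 r‖ ^ 2 + ‖D r‖ ^ 2) ∂(timeMeasure T) := by
    rw [integral_add, integral_norm_sq_continuousToL2 hw, integral_norm_sq_continuousToL2 hD,
      norm_sq_eq, toL2_ofSmooth, timeDeriv_ofSmooth, compLpL_continuousToL2]
    · exact memLp_one_iff_integrable.1 ((hw.norm.pow 2).memLp_timeMeasure T 1)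
    · exact memLp_one_iff_integrable.1 ((hD.norm.pow 2).memLp_timeMeasure T 1)
  set N := ‖ofSmooth ι hT.le w‖ ^ 2
  have hstep : ∀ s ∈ Icc 0 T, ‖ι (w.1 t)‖ ^ 2 ≤ ‖ι (w.1 s)‖ ^ 2 + N := by
    intro s hs
    have h1 := integral_inner_smooth ι w w s t
    rw [real_inner_self_eq_norm_sq, real_inner_self_eq_norm_sq] at h1
    rw [← sub_le_iff_le_add', ← h1, hN]
    refine (Real.le_norm_self _).trans
      ((intervalIntegral.norm_integral_le_integral_norm_uIoc).trans ?_)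
    have hI : uIoc s t ⊆ Ioc 0 T := fun r hr =>
      ⟨(le_min hs.1 ht.1).trans_lt hr.1, hr.2.trans (max_le hs.2 ht.2)⟩
    have hc : Continuous fun r => ‖w.1 r‖ ^ 2 + ‖D r‖ ^ 2 := (hw.norm.pow 2).add (hD.norm.pow 2)
    rw [timeMeasure, ← integral_Ioc_eq_integral_Ioo]
    have hi : IntegrableOn (fun r => ‖w.1 r‖ ^ 2 + ‖D r‖ ^ 2) (Ioc 0 T) :=
      hc.integrableOn_Ioc
    refine le_trans ?_ (setIntegral_mono_set hi
      (Filter.Eventually.of_forall fun r => by positivity) hI.eventuallyLE)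
    refine setIntegral_mono ?_ (hi.mono_set hI) fun r => ?_
    · exact ((((continuous_toDualV_smooth ι w w).add
        (continuous_toDualV_smooth ι w w)).norm).integrableOn_Ioc (a := 0) (b := T)).mono_set hI
    · have h2 : ‖toDualV ι (deriv w.1 r) (w.1 r)‖ ≤ ‖D r‖ * ‖w.1 r‖ :=
        ContinuousLinearMap.le_opNorm _ _
      have h3 := norm_add_le (toDualV ι (deriv w.1 r) (w.1 r)) (toDualV ι (deriv w.1 r) (w.1 r))
      change ‖_‖ ≤ ‖w.1 r‖ ^ 2 + ‖D r‖ ^ 2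
      nlinarith [sq_nonneg (‖D r‖ - ‖w.1 r‖)]
  -- The averaging: `hstep` is integrated over `s ∈ (0,T)` with `t` fixed.
  have hint : ∫ _, ‖ι (w.1 t)‖ ^ 2 ∂(timeMeasure T)
      ≤ ∫ s, (‖ι‖ ^ 2 * ‖w.1 s‖ ^ 2 + N) ∂(timeMeasure T) := by
    refine integral_mono_ae (integrable_const _) ?_ ?_
    · exact memLp_one_iff_integrable.1
        (((continuous_const.mul (hw.norm.pow 2)).add continuous_const).memLp_timeMeasure T 1)
    · filter_upwards [ae_restrict_mem measurableSet_Ioo] with s hs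
      have h4 : ‖ι (w.1 s)‖ ^ 2 ≤ ‖ι‖ ^ 2 * ‖w.1 s‖ ^ 2 := by
        rw [← mul_pow]
        gcongr
        exact ι.le_opNorm _
      linarith [hstep s (Ioo_subset_Icc_self hs)]
  have hvol : (timeMeasure T).real univ = T := by simp [hT.le]
  have hwi : Integrable (fun s => ‖ι‖ ^ 2 * ‖w.1 s‖ ^ 2) (timeMeasure T) :=
    memLp_one_iff_integrable.1 ((continuous_const.mul (hw.norm.pow 2)).memLp_timeMeasure T 1)
  rw [integral_add hwi (integrable_const _), integral_const_mul,
    integral_const, integral_const, hvol, smul_eq_mul, smul_eq_mul,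
    integral_norm_sq_continuousToL2 hw] at hint
  have h5 : ‖continuousToL2 T w.1 hw‖ ^ 2 ≤ N := by
    have := norm_toL2_le (ofSmooth ι hT.le w)
    rw [toL2_ofSmooth] at this
    exact pow_le_pow_left₀ (norm_nonneg _) this 2
  have h6 : T * ‖ι (w.1 t)‖ ^ 2 ≤ T * ((‖ι‖ ^ 2 / T + 1) * N) := by
    have e : T * ((‖ι‖ ^ 2 / T + 1) * N) = ‖ι‖ ^ 2 * N + T * N := by field_simp
    rw [e]
    nlinarith [mul_le_mul_of_nonneg_left h5 (sq_nonneg ‖ι‖)]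
  exact le_of_mul_le_mul_left h6 hT

/-- Restriction of smooth functions to continuous `H`-valued functions on `[0,T]`. -/
def smoothFunctions.toContinuousMap (T : ℝ) (ι : V →L[ℝ] H) :
    smoothFunctions V →ₗ[ℝ] C(Icc 0 T, H) where
  toFun w := ⟨fun t => ι (w.1 t), ι.continuous.comp
    ((smoothFunctions.continuous w).comp continuous_subtype_val)⟩
  map_add' _ _ := ContinuousMap.ext fun _ => map_add ι _ _
  map_smul' _ _ := ContinuousMap.ext fun _ => map_smul ι _ _

/-- The continuous representative in `C([0,T];H)` of an element of `W(0,T)`. -/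
def StateSpace.trajectory [CompleteSpace V] [CompleteSpace H] (ι : V →L[ℝ] H) (hT : 0 ≤ T) :
    StateSpace T ι →L[ℝ] C(Icc 0 T, H) :=
  (smoothFunctions.toContinuousMap T ι).extendOfNorm (ofSmooth ι hT)

/-- Density and the uniform bound `norm_sq_smooth_le` are what make the extension agree with the
original map on smooth functions. -/
theorem StateSpace.trajectory_ofSmooth [CompleteSpace V] [CompleteSpace H]
    (hι : Function.Injective ι) (hT : 0 < T) (w : smoothFunctions V) (t : Icc 0 T) :
    trajectory ι hT.le (ofSmooth ι hT.le w) t = ι (w.1 t) := by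
  rw [trajectory, LinearMap.extendOfNorm_eq (denseRange_ofSmooth hι hT)]
  · rfl
  · refine ⟨Real.sqrt (‖ι‖ ^ 2 / T + 1), fun w => ?_⟩
    rw [ContinuousMap.norm_le _ (by positivity)]
    intro t
    refine le_of_sq_le_sq ?_ (by positivity)
    rw [mul_pow, Real.sq_sqrt (by positivity)]
    exact norm_sq_smooth_le hT w t.2

/-- The embedding `C([0,T];X) → L²(0,T;X)`. -/
def continuousMapToL2 {X : Type*} [NormedAddCommGroup X] [NormedSpace ℝ X] (hT : 0 ≤ T) :
    C(Icc 0 T, X) →L[ℝ] L2Time T X :=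
  LinearMap.mkContinuousOfExistsBound
    { toFun := fun z => continuousToL2 T (IccExtend hT z) z.continuous.Icc_extend'
      map_add' := fun z₁ z₂ =>
        continuousToL2_add z₁.continuous.Icc_extend' z₂.continuous.Icc_extend' _ rfl
      map_smul' := fun c z => continuousToL2_smul c z.continuous.Icc_extend' _ rfl }
    ⟨measureUnivNNReal (timeMeasure T) ^ (2 : ℝ≥0∞).toReal⁻¹, fun z => by
      refine Lp.norm_le_of_ae_bound (norm_nonneg _) ?_
      have hz : Continuous (IccExtend hT z) := z.continuous.Icc_extend'
      filter_upwards [coeFn_continuousToL2 T hz] with t ht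
      exact (congrArg norm ht).trans_le (z.norm_coe_le_norm _)⟩

theorem coeFn_continuousMapToL2 {X : Type*} [NormedAddCommGroup X] [NormedSpace ℝ X] (hT : 0 ≤ T)
    (z : C(Icc 0 T, X)) : continuousMapToL2 hT z =ᵐ[timeMeasure T] IccExtend hT z :=
  coeFn_continuousToL2 T z.continuous.Icc_extend'

/-- Both sides are continuous in `y` and coincide on smooth functions. -/
theorem StateSpace.continuousMapToL2_trajectory [CompleteSpace V] [CompleteSpace H]
    (hι : Function.Injective ι) (hT : 0 < T) (y : StateSpace T ι) :
    continuousMapToL2 hT.le (trajectory ι hT.le y) = ι.compLpL 2 (timeMeasure T) (toL2 T ι y) := by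
  refine (denseRange_ofSmooth hι hT).induction_on
    (p := fun y => continuousMapToL2 hT.le (trajectory ι hT.le y)
      = ι.compLpL 2 (timeMeasure T) (toL2 T ι y)) y ?_ fun w => ?_
  · exact isClosed_eq (by fun_prop) (by fun_prop)
  · rw [toL2_ofSmooth, compLpL_continuousToL2]
    refine Lp.ext ?_
    filter_upwards [coeFn_continuousMapToL2 hT.le (trajectory ι hT.le (ofSmooth ι hT.le w)),
      coeFn_continuousToL2 T (ι.continuous.comp (smoothFunctions.continuous w)),
      ae_restrict_mem measurableSet_Ioo] with t h₁ h₂ ht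
    rw [h₁]
    refine Eq.trans ?_ h₂.symm
    rw [IccExtend_of_mem _ _ (Ioo_subset_Icc_self ht), trajectory_ofSmooth hι hT]
    rfl

theorem StateSpace.trajectory_ae_eq [CompleteSpace V] [CompleteSpace H]
    (hι : Function.Injective ι) (hT : 0 < T) (y : StateSpace T ι) :
    ∀ᵐ t ∂(timeMeasure T), IccExtend hT.le (trajectory ι hT.le y) t = ι (toL2 T ι y t) := by
  filter_upwards [coeFn_continuousMapToL2 hT.le (trajectory ι hT.le y),
    ι.coeFn_compLpL (toL2 T ι y)] with t h₁ h₂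
  rw [← h₁, continuousMapToL2_trajectory hι hT, h₂]

/-- Continuous functions that agree almost everywhere on `(0,T)` agree on `[0,T]`, endpoints
included. The initial condition thereby becomes an equation for a bounded linear trace. -/
theorem hasInitialValue_iff [CompleteSpace V] [CompleteSpace H] (hι : Function.Injective ι)
    (hT : 0 < T) (y : StateSpace T ι) (a : H) :
    HasInitialValue y a ↔ trajectory ι hT.le y ⟨0, left_mem_Icc.2 hT.le⟩ = a := by
  have hcont := (trajectory ι hT.le y).continuous.Icc_extend' (h := hT.le)
  have h0 : IccExtend hT.le (trajectory ι hT.le y) 0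
      = trajectory ι hT.le y ⟨0, left_mem_Icc.2 hT.le⟩ :=
    IccExtend_of_mem _ _ (left_mem_Icc.2 hT.le)
  constructor
  · rintro ⟨z, hz, hae, rfl⟩
    have he : IccExtend hT.le (trajectory ι hT.le y) =ᵐ[volume.restrict (Icc 0 T)] z := by
      rw [← restrict_Ioo_eq_restrict_Icc]
      filter_upwards [trajectory_ae_eq hι hT y, hae] with t h₁ h₂
      rw [h₁, h₂]
    rw [← h0]
    exact Measure.eqOn_Icc_of_ae_eq volume hT.ne he hcont.continuousOn hz (left_mem_Icc.2 hT.le)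
  · rintro rfl
    exact ⟨_, hcont.continuousOn, trajectory_ae_eq hι hT y, h0⟩

/-- Integration by parts in `W(0,T)`. -/
theorem StateSpace.integration_by_parts [CompleteSpace V] [CompleteSpace H]
    (hι : Function.Injective ι) (hT : 0 < T) (y p : StateSpace T ι) :
    dualPairing T V (timeDeriv T ι y) (toL2 T ι p) + dualPairing T V (timeDeriv T ι p) (toL2 T ι y)
      = ⟪trajectory ι hT.le y ⟨T, right_mem_Icc.2 hT.le⟩,
          trajectory ι hT.le p ⟨T, right_mem_Icc.2 hT.le⟩⟫
        - ⟪trajectory ι hT.le y ⟨0, left_mem_Icc.2 hT.le⟩,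
          trajectory ι hT.le p ⟨0, left_mem_Icc.2 hT.le⟩⟫ := by
  refine (denseRange_ofSmooth hι hT).induction_on₂ (p := fun y p : StateSpace T ι =>
    dualPairing T V (timeDeriv T ι y) (toL2 T ι p) + dualPairing T V (timeDeriv T ι p) (toL2 T ι y)
      = ⟪trajectory ι hT.le y ⟨T, right_mem_Icc.2 hT.le⟩,
          trajectory ι hT.le p ⟨T, right_mem_Icc.2 hT.le⟩⟫
        - ⟪trajectory ι hT.le y ⟨0, left_mem_Icc.2 hT.le⟩,
          trajectory ι hT.le p ⟨0, left_mem_Icc.2 hT.le⟩⟫) ?_ (fun w v => ?_) y p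
  · have hev : ∀ t : Icc 0 T, Continuous fun y : StateSpace T ι => trajectory ι hT.le y t :=
      fun t => (continuous_eval_const t).comp (ContinuousLinearMap.continuous _)
    have h₁ := hev ⟨T, right_mem_Icc.2 hT.le⟩
    have h₂ := hev ⟨0, left_mem_Icc.2 hT.le⟩
    refine isClosed_eq (by fun_prop) (Continuous.sub ?_ ?_)
    · exact (h₁.comp continuous_fst).inner (h₁.comp continuous_snd)
    · exact (h₂.comp continuous_fst).inner (h₂.comp continuous_snd)
  · have key : ∀ w v : smoothFunctions V,
        dualPairing T V (timeDeriv T ι (ofSmooth ι hT.le w)) (toL2 T ι (ofSmooth ι hT.le v))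
          = ∫ t, toDualV ι (deriv w.1 t) (v.1 t) ∂(timeMeasure T) := by
      intro w v
      rw [dualPairing_apply, timeDeriv_ofSmooth, toL2_ofSmooth]
      refine integral_congr_ae ?_
      filter_upwards [(toDualV ι).coeFn_compLpL
        (continuousToL2 T (deriv w.1) (smoothFunctions.continuous_deriv w)),
        coeFn_continuousToL2 T (smoothFunctions.continuous_deriv w),
        coeFn_continuousToL2 T (smoothFunctions.continuous v)] with t h₁ h₂ h₃
      rw [h₁, h₂, h₃]
    rw [key, key, ← integral_add, ← integral_Ioc_eq_integral_Ioo,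
      ← intervalIntegral.integral_of_le hT.le, integral_inner_smooth]
    · simp only [trajectory_ofSmooth hι hT]
    · exact memLp_one_iff_integrable.1 ((continuous_toDualV_smooth ι w v).memLp_timeMeasure T 1)
    · exact memLp_one_iff_integrable.1 ((continuous_toDualV_smooth ι v w).memLp_timeMeasure T 1)

end Trace

/-! ### The parabolic isomorphism -/

namespace ControlProblem

open StateSpace

variable {U V H : Type*}
  [NormedAddCommGroup U] [InnerProductSpace ℝ U]
  [NormedAddCommGroup V] [InnerProductSpace ℝ V]
  [NormedAddCommGroup H] [InnerProductSpace ℝ H]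

/-- The operator `L²(0,T;V) → L²(0,T;V')`, `y ↦ (t ↦ A(t) y(t))`. -/
def stateOperator (P : ControlProblem U V H) :
    L2Time P.T V →L[ℝ] L2Time P.T (StrongDual ℝ V) :=
  (ContinuousLinearMap.id ℝ (V →L[ℝ] StrongDual ℝ V)).holderL (timeMeasure P.T) ∞ 2 2 P.A

theorem coeFn_stateOperator (P : ControlProblem U V H) (f : L2Time P.T V) :
    P.stateOperator f =ᵐ[timeMeasure P.T] fun t => P.A t (f t) :=
  ContinuousLinearMap.coeFn_holder _ _ _

/-- Transposition of operators `V → V'`. -/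
def transpose (V : Type*) [NormedAddCommGroup V] [InnerProductSpace ℝ V] :
    (V →L[ℝ] StrongDual ℝ V) →L[ℝ] V →L[ℝ] StrongDual ℝ V :=
  (ContinuousLinearMap.flipₗᵢ ℝ V V ℝ).toContinuousLinearEquiv.toContinuousLinearMap

theorem transpose_apply (L : V →L[ℝ] StrongDual ℝ V) (v w : V) : transpose V L v w = L w v := rfl

/-- The operator `L²(0,T;V) → L²(0,T;V')`, `p ↦ (t ↦ A(t)' p(t))`. -/
def adjointStateOperator (P : ControlProblem U V H) :
    L2Time P.T V →L[ℝ] L2Time P.T (StrongDual ℝ V) :=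
  (transpose V).holderL (timeMeasure P.T) ∞ 2 2 P.A

theorem coeFn_adjointStateOperator (P : ControlProblem U V H) (f : L2Time P.T V) :
    P.adjointStateOperator f =ᵐ[timeMeasure P.T] fun t => transpose V (P.A t) (f t) := by
  have h := ContinuousLinearMap.coeFn_holder (𝕜 := ℝ) (E := V →L[ℝ] StrongDual ℝ V) (F := V)
    (G := StrongDual ℝ V) (r := 2) (transpose V) P.A f
  rw [adjointStateOperator, ContinuousLinearMap.holderL_apply_apply]
  exact h

theorem dualPairing_stateOperator (P : ControlProblem U V H) (f g : L2Time P.T V) :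
    dualPairing P.T V (P.stateOperator f) g = dualPairing P.T V (P.adjointStateOperator g) f := by
  rw [dualPairing_apply, dualPairing_apply]
  refine integral_congr_ae ?_
  filter_upwards [P.coeFn_stateOperator f, P.coeFn_adjointStateOperator g] with t h₁ h₂
  rw [h₁, h₂, transpose_apply]

theorem exists_coercive (P : ControlProblem U V H) : ∃ η : ℝ, 0 < η ∧ ∀ f : L2Time P.T V,
    η * ‖f‖ ^ 2 ≤ dualPairing P.T V (P.stateOperator f) f := by
  obtain ⟨η, hη, h⟩ := P.A_coercive
  refine ⟨η, hη, fun f => ?_⟩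
  rw [L2Time.norm_sq_eq, dualPairing_apply, ← integral_const_mul]
  refine integral_mono_ae (f.integrable_norm_sq.const_mul η)
    (integrable_dual_apply (P.stateOperator f) f) ?_
  filter_upwards [P.coeFn_stateOperator f, h] with t h₁ h₂
  rw [h₁]
  exact h₂ _

variable [CompleteSpace V] [CompleteSpace H]

/-- Evaluation at time `0` on `W(0,T)`. -/
def initialTrace (P : ControlProblem U V H) : P.W →L[ℝ] H :=
  ContinuousMap.evalCLM ℝ ⟨0, left_mem_Icc.2 P.T_pos.le⟩ ∘L trajectory P.ι P.T_pos.le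

/-- Evaluation at time `T` on `W(0,T)`. -/
def finalTrace (P : ControlProblem U V H) : P.W →L[ℝ] H :=
  ContinuousMap.evalCLM ℝ ⟨P.T, right_mem_Icc.2 P.T_pos.le⟩ ∘L trajectory P.ι P.T_pos.le

theorem initialTrace_ofSmooth (P : ControlProblem U V H) (w : smoothFunctions V) :
    P.initialTrace (ofSmooth P.ι P.T_pos.le w) = P.ι (w.1 0) :=
  trajectory_ofSmooth P.ι_injective P.T_pos w _

theorem finalTrace_ofSmooth (P : ControlProblem U V H) (w : smoothFunctions V) :
    P.finalTrace (ofSmooth P.ι P.T_pos.le w) = P.ι (w.1 P.T) :=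
  trajectory_ofSmooth P.ι_injective P.T_pos w _

theorem hasInitialValue_iff (P : ControlProblem U V H) (y : P.W) (a : H) :
    HasInitialValue y a ↔ P.initialTrace y = a :=
  _root_.hasInitialValue_iff P.ι_injective P.T_pos y a

theorem integration_by_parts (P : ControlProblem U V H) (y p : P.W) :
    dualPairing P.T V (timeDeriv P.T P.ι y) (toL2 P.T P.ι p)
        + dualPairing P.T V (timeDeriv P.T P.ι p) (toL2 P.T P.ι y)
      = ⟪P.finalTrace y, P.finalTrace p⟫ - ⟪P.initialTrace y, P.initialTrace p⟫ :=
  StateSpace.integration_by_parts P.ι_injective P.T_pos y p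

/-- The isomorphism `L²(0,T;V') → L²(0,T;V)` induced by the Riesz isomorphism. -/
def rieszSymmL2 (T : ℝ) (V : Type*) [NormedAddCommGroup V] [InnerProductSpace ℝ V]
    [CompleteSpace V] : L2Time T (StrongDual ℝ V) →L[ℝ] L2Time T V :=
  (riesz V).symm.toContinuousLinearEquiv.toContinuousLinearMap.compLpL 2 (timeMeasure T)

theorem coeFn_rieszSymmL2 {T : ℝ} (f : L2Time T (StrongDual ℝ V)) :
    rieszSymmL2 T V f =ᵐ[timeMeasure T] fun t => (riesz V).symm (f t) :=
  ContinuousLinearMap.coeFn_compLpL _ _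

theorem norm_rieszSymmL2 {T : ℝ} (f : L2Time T (StrongDual ℝ V)) : ‖rieszSymmL2 T V f‖ = ‖f‖ := by
  rw [Lp.norm_def, Lp.norm_def]
  congr 1
  refine eLpNorm_congr_norm_ae ?_
  filter_upwards [coeFn_rieszSymmL2 f] with t ht
  rw [ht, LinearIsometryEquiv.norm_map]

theorem inner_rieszSymmL2 {T : ℝ} (f : L2Time T (StrongDual ℝ V)) (g : L2Time T V) :
    ⟪rieszSymmL2 T V f, g⟫ = dualPairing T V f g := by
  rw [L2.inner_def, dualPairing_apply]
  refine integral_congr_ae ?_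
  filter_upwards [coeFn_rieszSymmL2 f] with t ht
  rw [ht, inner_riesz_symm]

theorem dualPairing_le {T : ℝ} (f : L2Time T (StrongDual ℝ V)) (g : L2Time T V) :
    dualPairing T V f g ≤ ‖f‖ * ‖g‖ := by
  rw [← inner_rieszSymmL2, ← norm_rieszSymmL2 f]
  exact real_inner_le_norm _ _

/-- The parabolic operator `y ↦ (∂ₜ y + A y, y(0))`. -/
def parabolicOperator (P : ControlProblem U V H) : P.W →L[ℝ] WithLp 2 (L2Time P.T V × H) :=
  (WithLp.prodContinuousLinearEquiv 2 ℝ (L2Time P.T V) H).symm.toContinuousLinearMap ∘L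
    (rieszSymmL2 P.T V ∘L (timeDeriv P.T P.ι + P.stateOperator ∘L toL2 P.T P.ι)).prod
      P.initialTrace

theorem parabolicOperator_apply (P : ControlProblem U V H) (y : P.W) :
    P.parabolicOperator y = WithLp.toLp 2 (rieszSymmL2 P.T V
      (timeDeriv P.T P.ι y + P.stateOperator (toL2 P.T P.ι y)), P.initialTrace y) := rfl

/-- The energy estimate. -/
theorem exists_norm_le_parabolicOperator (P : ControlProblem U V H) :
    ∃ C : ℝ, 0 ≤ C ∧ ∀ y : P.W, ‖y‖ ≤ C * ‖P.parabolicOperator y‖ := by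
  obtain ⟨η, hη, hc⟩ := P.exists_coercive
  set c := 1 + 2 / η
  refine ⟨c + (1 + ‖P.stateOperator‖ * c), by positivity, fun y => ?_⟩
  set f := toL2 P.T P.ι y with hf
  set g := timeDeriv P.T P.ι y with hg
  set F := g + P.stateOperator f with hF
  set m := ‖P.parabolicOperator y‖
  have hm : m ^ 2 = ‖F‖ ^ 2 + ‖P.initialTrace y‖ ^ 2 := by
    rw [← norm_rieszSymmL2 F]
    exact WithLp.prod_norm_sq_eq_of_L2 _
  have hm0 : 0 ≤ m := norm_nonneg _
  have hFm : ‖F‖ ≤ m := le_of_sq_le_sq (by rw [hm]; nlinarith [sq_nonneg ‖P.initialTrace y‖]) hm0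
  have hparts := P.integration_by_parts y y
  rw [real_inner_self_eq_norm_sq, real_inner_self_eq_norm_sq, ← hf, ← hg] at hparts
  have h1 := hc f
  have h2 : dualPairing P.T V F f
      = dualPairing P.T V g f + dualPairing P.T V (P.stateOperator f) f := by
    rw [hF, map_add, add_apply]
  have h3 : dualPairing P.T V F f ≤ m * ‖f‖ :=
    (dualPairing_le F f).trans (by gcongr)
  -- Here `⟨Af, f⟩ = ⟨F, f⟩ - ⟨g, f⟩`, and integration by parts gives `-2⟨g, f⟩ = |y(0)|² - |y(T)|²
  -- ≤ m²`.
  have h4 : η * ‖f‖ ^ 2 ≤ m * ‖f‖ + m ^ 2 := by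
    nlinarith [sq_nonneg ‖P.finalTrace y‖, sq_nonneg ‖F‖, sq_nonneg ‖P.initialTrace y‖]
  have h5 : ‖f‖ ≤ c * m := by
    -- Either `‖f‖ ≤ m`, or `m² ≤ m‖f‖` and the quadratic inequality reduces to `η‖f‖ ≤ 2m`; `c = 1
    -- + 2/η` covers both cases.
    rcases le_total ‖f‖ m with h | h
    · refine h.trans (le_mul_of_one_le_left hm0 ?_)
      simp only [c, le_add_iff_nonneg_right]
      positivity
    · rcases (norm_nonneg f).eq_or_lt with h0 | h0
      · rw [← h0]; positivity
      have h6 : η * ‖f‖ ≤ 2 * m := by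
        refine le_of_mul_le_mul_right ?_ h0
        nlinarith
      have h7 : ‖f‖ ≤ 2 / η * m := by
        rw [div_mul_eq_mul_div, le_div_iff₀ hη]
        linarith
      have : c * m = m + 2 / η * m := by simp only [c]; ring
      linarith
  have h8 : ‖g‖ ≤ m + ‖P.stateOperator‖ * (c * m) := by
    have : g = F - P.stateOperator f := by rw [hF, add_sub_cancel_right]
    rw [this]
    refine (norm_sub_le _ _).trans (add_le_add hFm ((P.stateOperator.le_opNorm f).trans ?_))
    gcongr
  have := norm_le_add y
  rw [← hf, ← hg] at this
  nlinarith

/-- A function annihilating the range of the parabolic operator on test functions is a weak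
solution of the adjoint equation. -/
theorem isWeakTimeDeriv_of_annihilates (P : ControlProblem U V H) {p : L2Time P.T V} {h : H}
    (hp : ∀ y : P.W, dualPairing P.T V (timeDeriv P.T P.ι y) p
      + dualPairing P.T V (P.adjointStateOperator p) (toL2 P.T P.ι y)
      + ⟪P.initialTrace y, h⟫ = 0) :
    IsWeakTimeDeriv P.T ((toDualV P.ι).compLpL 2 (timeMeasure P.T) p)
      (P.adjointStateOperator p) := by
  intro φ hφ
  ext v
  rw [ContinuousLinearMap.integral_apply (hφ.integrable_deriv_smul _),
    neg_apply, ContinuousLinearMap.integral_apply (hφ.integrable_smul _),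
    eq_neg_iff_add_eq_zero]
  have hw : ContDiff ℝ 1 fun t => φ t • v := (hφ.1.of_le (by simp)).smul contDiff_const
  -- Testing with `y(t) = φ(t) v`, whose initial value is zero, turns the annihilation into the weak
  -- derivative identity evaluated at `v`.
  let w : smoothFunctions V := ⟨fun t => φ t • v, hw⟩
  have hderiv : ∀ t, deriv w.1 t = deriv φ t • v := fun t =>
    (((hφ.1.differentiable (by simp)) t).hasDerivAt.smul_const v).deriv
  have key := hp (ofSmooth P.ι P.T_pos.le w)
  have h0 : w.1 0 = 0 := by
    change φ 0 • v = 0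
    rw [hφ.eq_zero (by simp), zero_smul]
  rw [P.initialTrace_ofSmooth, h0, map_zero, inner_zero_left, add_zero, dualPairing_apply,
    dualPairing_apply, toL2_ofSmooth, timeDeriv_ofSmooth] at key
  refine Eq.trans (congrArg₂ (· + ·) (integral_congr_ae ?_) (integral_congr_ae ?_)) key
  · filter_upwards [(toDualV P.ι).coeFn_compLpL p, (toDualV P.ι).coeFn_compLpL
      (continuousToL2 P.T (deriv w.1) (smoothFunctions.continuous_deriv w)),
      coeFn_continuousToL2 P.T (smoothFunctions.continuous_deriv w)] with t h₁ h₂ h₃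
    rw [h₁, h₂, h₃, hderiv]
    simp [real_inner_comm]
  · filter_upwards [coeFn_continuousToL2 P.T (smoothFunctions.continuous w)] with t h₁
    rw [h₁]
    simp [w]

/-- Once `p` is known to lie in `W(0,T)`, integration by parts leaves only boundary terms. They
identify `p(T) = 0` and `p(0) = h`, and an energy argument for the backward equation finishes. -/
theorem eq_zero_of_annihilates (P : ControlProblem U V H) {p : L2Time P.T V} {h : H}
    (hp : ∀ y : P.W, dualPairing P.T V (timeDeriv P.T P.ι y) p
      + dualPairing P.T V (P.adjointStateOperator p) (toL2 P.T P.ι y)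
      + ⟪P.initialTrace y, h⟫ = 0) : p = 0 ∧ h = 0 := by
  let q : P.W := StateSpace.mk p (P.adjointStateOperator p) (P.isWeakTimeDeriv_of_annihilates hp)
  have hq : ∀ y : P.W, ⟪P.finalTrace y, P.finalTrace q⟫ - ⟪P.initialTrace y, P.initialTrace q⟫
      + ⟪P.initialTrace y, h⟫ = 0 := fun y => by
    rw [← P.integration_by_parts]
    exact hp y
  have hdense : ∀ x : H, (∀ v, ⟪P.ι v, x⟫ = 0) → x = 0 := fun x hx =>
    P.ι_denseRange.eq_zero_of_inner_left ℝ fun v => (real_inner_comm _ _).trans (hx v)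
  have hfinal : P.finalTrace q = 0 := hdense _ fun v => by
    -- The function `t v` vanishes at `0` and isolates the final trace; constants then give the
    -- initial one.
    have hw : ContDiff ℝ 1 fun t : ℝ => t • v := contDiff_id.smul contDiff_const
    have h1 := hq (ofSmooth P.ι P.T_pos.le ⟨_, hw⟩)
    rw [P.finalTrace_ofSmooth, P.initialTrace_ofSmooth] at h1
    simpa [real_inner_smul_left, P.T_pos.ne'] using h1
  have hinit : P.initialTrace q = h := by
    refine (sub_eq_zero.1 (hdense (h - P.initialTrace q) fun v => ?_)).symm
    have hw : ContDiff ℝ 1 fun _ : ℝ => v := contDiff_const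
    have h1 := hq (ofSmooth P.ι P.T_pos.le ⟨_, hw⟩)
    rw [P.initialTrace_ofSmooth, hfinal, inner_zero_right] at h1
    rw [inner_sub_right]
    linarith
  obtain ⟨η, hη, hc⟩ := P.exists_coercive
  have h2 := P.integration_by_parts q q
  rw [hfinal, hinit, inner_zero_right, real_inner_self_eq_norm_sq] at h2
  have h3 : dualPairing P.T V (timeDeriv P.T P.ι q) (toL2 P.T P.ι q)
      = dualPairing P.T V (P.stateOperator p) p := (P.dualPairing_stateOperator p p).symm
  rw [h3] at h2
  -- Now `2⟨A p, p⟩ = -|h|²`, so coercivity gives `2η‖p‖² + |h|² ≤ 0`.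
  have h4 := hc p
  have h5 : ‖p‖ ^ 2 = 0 := by nlinarith [sq_nonneg ‖p‖, sq_nonneg ‖h‖]
  have h6 : ‖h‖ ^ 2 = 0 := by nlinarith [sq_nonneg ‖p‖, sq_nonneg ‖h‖]
  exact ⟨by simpa using h5, by simpa using h6⟩

theorem injective_parabolicOperator (P : ControlProblem U V H) :
    (P.parabolicOperator : P.W →ₗ[ℝ] WithLp 2 (L2Time P.T V × H)).ker = ⊥ := by
  obtain ⟨C, -, hC⟩ := P.exists_norm_le_parabolicOperator
  refine (Submodule.eq_bot_iff _).2 fun y hy => ?_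
  have h1 : P.parabolicOperator y = 0 := hy
  have h2 := hC y
  rw [h1, norm_zero, mul_zero] at h2
  exact norm_le_zero_iff.1 h2

/-- The energy estimate makes the range closed, so it is enough that its orthogonal complement is
trivial. -/
theorem surjective_parabolicOperator (P : ControlProblem U V H) :
    (P.parabolicOperator : P.W →ₗ[ℝ] WithLp 2 (L2Time P.T V × H)).range = ⊤ := by
  obtain ⟨C, hC0, hC⟩ := P.exists_norm_le_parabolicOperator
  have hanti : AntilipschitzWith ⟨C, hC0⟩ P.parabolicOperator :=
    P.parabolicOperator.antilipschitz_of_bound hC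
  have hclosed : IsClosed (range P.parabolicOperator) :=
    hanti.isClosed_range P.parabolicOperator.uniformContinuous
  set K := (P.parabolicOperator : P.W →ₗ[ℝ] WithLp 2 (L2Time P.T V × H)).range
  have hK : IsClosed (K : Set (WithLp 2 (L2Time P.T V × H))) := by
    rwa [LinearMap.coe_range]
  have : CompleteSpace K := hK.completeSpace_coe
  -- Orthogonality is available because the target was made a Hilbert space by replacing
  -- `L²(0,T;V')` with `L²(0,T;V)` through Riesz.
  rw [← Submodule.orthogonal_eq_bot_iff, Submodule.eq_bot_iff]
  intro x hx
  have hp : ∀ y : P.W, dualPairing P.T V (timeDeriv P.T P.ι y) x.fst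
      + dualPairing P.T V (P.adjointStateOperator x.fst) (toL2 P.T P.ι y)
      + ⟪P.initialTrace y, x.snd⟫ = 0 := fun y => by
    have h1 : ⟪P.parabolicOperator y, x⟫ = 0 := hx _ ⟨y, rfl⟩
    rw [WithLp.prod_inner_apply, parabolicOperator_apply] at h1
    change ⟪rieszSymmL2 P.T V _, x.fst⟫ + ⟪P.initialTrace y, x.snd⟫ = 0 at h1
    rwa [inner_rieszSymmL2, map_add, add_apply,
      dualPairing_stateOperator] at h1
  obtain ⟨h1, h2⟩ := P.eq_zero_of_annihilates hp
  exact WithLp.ofLp_injective 2 (Prod.ext h1 h2)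

/-- The parabolic operator is an isomorphism. -/
def parabolicEquiv (P : ControlProblem U V H) : P.W ≃L[ℝ] WithLp 2 (L2Time P.T V × H) :=
  ContinuousLinearEquiv.ofBijective P.parabolicOperator P.injective_parabolicOperator
    P.surjective_parabolicOperator

theorem parabolicEquiv_apply (P : ControlProblem U V H) (y : P.W) :
    P.parabolicEquiv y = P.parabolicOperator y := rfl

/-- The right-hand side of the state equation. -/
def rightHandSide (P : ControlProblem U V H) : L2Time P.T U →L[ℝ] L2Time P.T V :=
  rieszSymmL2 P.T V ∘L P.B.compLpL 2 (timeMeasure P.T)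

/-- The equation almost everywhere is an equality in `L²(0,T;V')`, and the Riesz map is injective.
Existence, uniqueness and continuous dependence follow at once from the isomorphism. -/
theorem solvesState_iff (P : ControlProblem U V H) (a : H) (u : L2Time P.T U) (y : P.W) :
    P.SolvesState a u y ↔ y = P.parabolicEquiv.symm (WithLp.toLp 2 (P.rightHandSide u, a)) := by
  rw [ContinuousLinearEquiv.eq_symm_apply, parabolicEquiv_apply, parabolicOperator_apply,
    SolvesState, P.hasInitialValue_iff, (WithLp.toLp_injective 2).eq_iff, Prod.mk.injEq]
  refine and_congr_left fun _ => ?_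
  have hae := P.coeFn_stateOperator (toL2 P.T P.ι y)
  have hB := P.B.coeFn_compLpL (μ := timeMeasure P.T) (p := 2) u
  have hadd := Lp.coeFn_add (timeDeriv P.T P.ι y) (P.stateOperator (toL2 P.T P.ι y))
  have hinj : ∀ f g : L2Time P.T (StrongDual ℝ V),
      rieszSymmL2 P.T V f = rieszSymmL2 P.T V g ↔ f = g := fun f g => by
    rw [← sub_eq_zero, ← map_sub, ← norm_eq_zero, norm_rieszSymmL2, norm_eq_zero, sub_eq_zero]
  rw [rightHandSide, ContinuousLinearMap.comp_apply, hinj]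
  constructor
  · intro h
    refine Lp.ext ?_
    filter_upwards [h, hae, hB, hadd] with t h₁ h₂ h₃ h₄
    rw [h₄, Pi.add_apply, h₂, h₁, h₃]
  · intro h
    rw [h] at hadd
    filter_upwards [hae, hB, hadd] with t h₂ h₃ h₄
    rw [← h₃, h₄, Pi.add_apply, h₂]

end ControlProblem

/-! ### Tikhonov functionals on Hilbert spaces -/

section QuadraticFunctional

variable {X Y : Type*} [NormedAddCommGroup X] [InnerProductSpace ℝ X] [CompleteSpace X]
  [NormedAddCommGroup Y] [InnerProductSpace ℝ Y] [CompleteSpace Y]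

/-- The Tikhonov functional `u ↦ ½|F u + d|² + (β/2)|u|²`. -/
def tikhonov (F : X →L[ℝ] Y) (d : Y) (β : ℝ) (u : X) : ℝ :=
  (1 / 2) * ‖F u + d‖ ^ 2 + (β / 2) * ‖u‖ ^ 2

/-- The gradient of the Tikhonov functional. -/
def tikhonovGradient (F : X →L[ℝ] Y) (d : Y) (β : ℝ) (u : X) : X :=
  F.adjoint (F u + d) + β • u

theorem hasGradientAt_tikhonov (F : X →L[ℝ] Y) (d : Y) (β : ℝ) (u : X) :
    HasGradientAt (tikhonov F d β) (tikhonovGradient F d β u) u := by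
  have h₁ : HasFDerivAt (fun u => F u + d) F u := F.hasFDerivAt.add_const d
  have h := (h₁.norm_sq.const_mul (1 / 2)).add ((hasFDerivAt_id u).norm_sq.const_mul (β / 2))
  refine hasGradientAt_iff_hasFDerivAt.2 (h.congr_fderiv ?_)
  ext v
  simp [tikhonovGradient, ContinuousLinearMap.adjoint_inner_left]
  ring

/-- The functional is quadratic, so its second-order Taylor expansion is exact; at a critical point
the term with `β/2` gives strict minimality. -/
theorem tikhonov_sub (F : X →L[ℝ] Y) (d : Y) (β : ℝ) (u v : X) :
    tikhonov F d β v = tikhonov F d β u + ⟪tikhonovGradient F d β u, v - u⟫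
      + (1 / 2) * ‖F (v - u)‖ ^ 2 + (β / 2) * ‖v - u‖ ^ 2 := by
  obtain ⟨w, rfl⟩ : ∃ w, v = u + w := ⟨v - u, by abel⟩
  have h₁ : F (u + w) + d = (F u + d) + F w := by rw [map_add]; abel
  rw [add_sub_cancel_left, tikhonov, tikhonov, tikhonovGradient, h₁, norm_add_sq_real (F u + d),
    norm_add_sq_real u, inner_add_left (F.adjoint (F u + d)), real_inner_smul_left,
    ContinuousLinearMap.adjoint_inner_left]
  ring

/-- The equation `(F*F + β)u = -F*d` is solved by the resolvent of the positive operator `F*F`. -/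
theorem exists_tikhonovGradient_eq_zero (F : X →L[ℝ] Y) (d : Y) {β : ℝ} (hβ : 0 < β) :
    ∃ u, tikhonovGradient F d β u = 0 := by
  obtain ⟨q, hq, -⟩ := exists_resolvent (G := F.adjoint ∘L F) (fun x => by
    rw [ContinuousLinearMap.comp_apply, ContinuousLinearMap.adjoint_inner_left]
    exact real_inner_self_nonneg) hβ
  refine ⟨q (-F.adjoint d), ?_⟩
  have h := hq (-F.adjoint d)
  rw [ContinuousLinearMap.comp_apply] at h
  rw [tikhonovGradient, map_add, add_right_comm, h, neg_add_cancel]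

theorem tikhonov_le_iff (F : X →L[ℝ] Y) (d : Y) {β : ℝ} (hβ : 0 < β) {u : X}
    (hu : tikhonovGradient F d β u = 0) (v : X) :
    tikhonov F d β v ≤ tikhonov F d β u ↔ v = u := by
  refine ⟨fun h => ?_, fun h => h ▸ le_rfl⟩
  rw [tikhonov_sub F d β u v, hu, inner_zero_left] at h
  have h0 : ‖v - u‖ ^ 2 = 0 := by
    nlinarith [sq_nonneg ‖F (v - u)‖, sq_nonneg ‖v - u‖]
  exact sub_eq_zero.1 (by simpa using h0)

theorem tikhonov_le (F : X →L[ℝ] Y) (d : Y) {β : ℝ} (hβ : 0 < β) {u : X}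
    (hu : tikhonovGradient F d β u = 0) (v : X) : tikhonov F d β u ≤ tikhonov F d β v := by
  rw [tikhonov_sub F d β u v, hu, inner_zero_left]
  nlinarith [sq_nonneg ‖F (v - u)‖, sq_nonneg ‖v - u‖]

/-- The gradient is affine with linear part `F*F + β`, and `u` is its zero. Both halves of the error
estimate are bounds for this linear part. -/
theorem tikhonovGradient_eq (F : X →L[ℝ] Y) (d : Y) (β : ℝ) {u : X}
    (hu : tikhonovGradient F d β u = 0) (v : X) :
    tikhonovGradient F d β v = F.adjoint (F (v - u)) + β • (v - u) := by
  rw [← sub_zero (tikhonovGradient F d β v), ← hu, tikhonovGradient, tikhonovGradient]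
  simp only [map_add, map_sub, smul_sub]
  abel

theorem norm_tikhonovGradient_le (F : X →L[ℝ] Y) (d : Y) {β : ℝ} (hβ : 0 < β) {u : X}
    (hu : tikhonovGradient F d β u = 0) (v : X) :
    ‖tikhonovGradient F d β v‖ ≤ (β + ‖F‖ ^ 2) * ‖u - v‖ := by
  rw [tikhonovGradient_eq F d β hu, norm_sub_rev u]
  have h₁ : ‖F.adjoint (F (v - u))‖ ≤ ‖F‖ * (‖F‖ * ‖v - u‖) := by
    refine (F.adjoint.le_opNorm _).trans ?_
    rw [LinearIsometryEquiv.norm_map]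
    gcongr
    exact F.le_opNorm _
  have h₂ : ‖β • (v - u)‖ = β * ‖v - u‖ := by rw [norm_smul, Real.norm_of_nonneg hβ.le]
  have h₃ := norm_add_le (F.adjoint (F (v - u))) (β • (v - u))
  nlinarith

/-- Pairing the gradient with `v - u` gives `‖F(v - u)‖² + β‖v - u‖²`; the first term is dropped and
Cauchy–Schwarz applied. -/
theorem le_norm_tikhonovGradient (F : X →L[ℝ] Y) (d : Y) (β : ℝ) {u : X}
    (hu : tikhonovGradient F d β u = 0) (v : X) :
    β * ‖u - v‖ ≤ ‖tikhonovGradient F d β v‖ := by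
  rw [norm_sub_rev u]
  rcases (norm_nonneg (v - u)).eq_or_lt with h0 | h0
  · rw [← h0, mul_zero]
    exact norm_nonneg _
  refine le_of_mul_le_mul_right ?_ h0
  refine le_trans ?_ (real_inner_le_norm (tikhonovGradient F d β v) (v - u))
  rw [tikhonovGradient_eq F d β hu, inner_add_left, real_inner_smul_left,
    ContinuousLinearMap.adjoint_inner_left, real_inner_self_eq_norm_sq, real_inner_self_eq_norm_sq]
  nlinarith [sq_nonneg ‖F (v - u)‖]

end QuadraticFunctional

/-! ### Reduction of the control problem to a Tikhonov functional -/

namespace ControlProblem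

open StateSpace

variable {U V H : Type*}
  [NormedAddCommGroup U] [InnerProductSpace ℝ U]
  [NormedAddCommGroup V] [InnerProductSpace ℝ V]
  [NormedAddCommGroup H] [InnerProductSpace ℝ H]

theorem cost_eq (P : ControlProblem U V H) (y : P.W) (u : L2Time P.T U) :
    P.cost y u = (1 / 2) * ‖P.observation (P.ι.compLpL 2 (timeMeasure P.T) (toL2 P.T P.ι y))
      - P.yd‖ ^ 2 + (P.β / 2) * ‖u‖ ^ 2 := by
  set z := P.ι.compLpL 2 (timeMeasure P.T) (toL2 P.T P.ι y)
  have hobs : P.observation z =ᵐ[timeMeasure P.T] fun t => P.C t (z t) :=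
    ContinuousLinearMap.coeFn_holder _ _ _
  rw [L2Time.norm_sq_eq, L2Time.norm_sq_eq, ← integral_const_mul, ← integral_const_mul,
    ← integral_add ((L2Time.integrable_norm_sq _).const_mul _)
      ((L2Time.integrable_norm_sq _).const_mul _)]
  refine integral_congr_ae ?_
  filter_upwards [hobs, P.ι.coeFn_compLpL (toL2 P.T P.ι y),
    Lp.coeFn_sub (P.observation z) P.yd] with t h₁ h₂ h₃
  rw [h₃, Pi.sub_apply, h₁, h₂]

variable [CompleteSpace V] [CompleteSpace H]

theorem solvesState_iff_eq_state (P : ControlProblem U V H) (u : L2Time P.T U) (y : P.W) :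
    P.SolvesState P.y₀ u y ↔ y = P.state u := by
  have h : P.SolvesState P.y₀ u (P.state u) :=
    Classical.epsilon_spec (p := fun y => P.SolvesState P.y₀ u y)
      ⟨_, (P.solvesState_iff _ _ _).2 rfl⟩
  rw [P.solvesState_iff] at h ⊢
  rw [h]

/-- The choice operator needs one bounded linear witness, the inverse parabolic operator applied to
`(Bu, 0)`; uniqueness then identifies the chosen one. -/
theorem solvesState_iff_eq_solutionOperator (P : ControlProblem U V H) (u : L2Time P.T U)
    (y : P.W) : P.SolvesState 0 u y ↔ y = P.solutionOperator u := by
  have h : ∀ u, P.SolvesState 0 u (P.solutionOperator u) :=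
    Classical.epsilon_spec (p := fun S : L2Time P.T U →L[ℝ] P.W => ∀ u, P.SolvesState 0 u (S u))
      ⟨P.parabolicEquiv.symm.toContinuousLinearMap ∘L
        (WithLp.prodContinuousLinearEquiv 2 ℝ (L2Time P.T V) H).symm.toContinuousLinearMap ∘L
          P.rightHandSide.prod 0, fun u => (P.solvesState_iff _ _ _).2 rfl⟩
  have hu := h u
  rw [P.solvesState_iff] at hu ⊢
  rw [hu]

theorem exists_state_eq (P : ControlProblem U V H) :
    ∃ y : P.W, ∀ u, P.state u = P.solutionOperator u + y := by
  -- Superposition: this is the uncontrolled state starting at `y₀`.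
  refine ⟨P.parabolicEquiv.symm (WithLp.toLp 2 (0, P.y₀)), fun u => ?_⟩
  rw [(P.solvesState_iff _ _ _).1 ((P.solvesState_iff_eq_state u _).2 rfl),
    (P.solvesState_iff _ _ _).1 ((P.solvesState_iff_eq_solutionOperator u _).2 rfl), ← map_add,
    ← WithLp.toLp_add, Prod.mk_add_mk, add_zero, zero_add]

theorem exists_reducedCost_eq (P : ControlProblem U V H) :
    ∃ d, P.reducedCost = tikhonov P.observedSolutionOperator d P.β := by
  obtain ⟨y, hy⟩ := P.exists_state_eq
  refine ⟨P.observation (P.ι.compLpL 2 (timeMeasure P.T) (toL2 P.T P.ι y)) - P.yd,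
    funext fun u => ?_⟩
  rw [reducedCost, cost_eq, hy, map_add, map_add, map_add, add_sub_assoc]
  rfl

theorem isOptimalControl_iff (P : ControlProblem U V H) (u : L2Time P.T U) :
    P.IsOptimalControl u ↔ ∀ v, P.reducedCost u ≤ P.reducedCost v := by
  simp only [IsOptimalControl, P.solvesState_iff_eq_state, exists_eq_left, reducedCost]
  exact ⟨fun h v => h _ v rfl, fun h y v hy => hy ▸ h v⟩

end ControlProblem

end

/-! ### The a posteriori error estimate -/

theorem mainTheorem2 {U V H : Type*}
    [NormedAddCommGroup U] [InnerProductSpace ℝ U] [CompleteSpace U]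
    [TopologicalSpace.SeparableSpace U]
    [NormedAddCommGroup V] [InnerProductSpace ℝ V] [CompleteSpace V]
    [TopologicalSpace.SeparableSpace V]
    [NormedAddCommGroup H] [InnerProductSpace ℝ H] [CompleteSpace H]
    [TopologicalSpace.SeparableSpace H]
    (P : ControlProblem U V H) :
    -- the state equation is uniquely solvable, by `P.state u` for the initial value `y₀` ...
    (∀ (u : L2Time P.T U) (y : P.W), P.SolvesState P.y₀ u y ↔ y = P.state u) ∧
    -- ... and by the bounded linear operator `P.solutionOperator` for the initial value `0`
    (∀ (u : L2Time P.T U) (y : P.W), P.SolvesState 0 u y ↔ y = P.solutionOperator u) ∧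
    -- there is exactly one optimal control
    (∃! ubar : L2Time P.T U, P.IsOptimalControl ubar) ∧
    -- the reduced cost is differentiable, so that its gradient is meaningful
    Differentiable ℝ P.reducedCost ∧
    -- the a posteriori error estimate
    ∀ ubar : L2Time P.T U, P.IsOptimalControl ubar → ∀ utilde : L2Time P.T U,
      1 / (P.β + ‖P.observedSolutionOperator‖ ^ 2) * ‖gradient P.reducedCost utilde‖
          ≤ ‖ubar - utilde‖ ∧
        ‖ubar - utilde‖ ≤ 1 / P.β * ‖gradient P.reducedCost utilde‖ := by
  obtain ⟨d, hd⟩ := P.exists_reducedCost_eq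
  obtain ⟨u₀, hu₀⟩ := exists_tikhonovGradient_eq_zero P.observedSolutionOperator d P.β_pos
  -- Optimal controls are the global minimisers of the reduced cost, and the critical point `u₀` is
  -- the only one.
  have hopt : ∀ u, P.IsOptimalControl u ↔ u = u₀ := fun u => by
    rw [P.isOptimalControl_iff, hd, ← tikhonov_le_iff P.observedSolutionOperator d P.β_pos hu₀]
    exact ⟨fun h => h _, fun h v => h.trans (tikhonov_le _ d P.β_pos hu₀ v)⟩
  refine ⟨P.solvesState_iff_eq_state, P.solvesState_iff_eq_solutionOperator,
    ⟨u₀, (hopt u₀).2 rfl, fun u => (hopt u).1⟩, ?_, ?_⟩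
  · rw [hd]
    exact fun u => (hasGradientAt_tikhonov _ d P.β u).differentiableAt
  · intro ubar hubar utilde
    obtain rfl := (hopt ubar).1 hubar
    rw [hd, (hasGradientAt_tikhonov _ d P.β utilde).gradient]
    have hβ := P.β_pos
    constructor
    · rw [one_div, inv_mul_le_iff₀ (by positivity)]
      exact norm_tikhonovGradient_le _ d hβ hu₀ utilde
    · rw [one_div, le_inv_mul_iff₀ hβ]
      exact le_norm_tikhonovGradient _ d P.β hu₀ utilde
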